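/- Let $\Gamma$ be a 3-crystallographic group, i.e. a subgroup of $O(3)\ltimes\mathbb R^3$ acting properly discontinuously and cocompactly on $\mathbb R^3$, and let $G$ be a subgroup of $\Gamma$. Suppose that $G$ has a dihedral action on a line $l\subset\mathbb R^3$: $G$ leaves $l$ invariant, acts cocompactly on $l$, and does not act on $l$ only by translations, i.e. some element of $G$ restricts to the reflection of $l$ about one of its points. Let $F=\{g\in G : g|_l=\mathrm{id}_l\}$ and, for $p\in l$, let $G^{\{p\}}=\{g\in G: gp=p\}\supseteq F$. Then there are distinct points $p_a,p_b\in l$ such that, with $G^a=G^{\{p_a\}}$ and $G^b=G^{\{p_b\}}$, the inclusions of $G^a$ and $G^b$ into $G$ induce an isomorphism $$G^a*_F G^b\;\cong\; G,$$ and, up to isomorphism of each of the three groups, $(F,G^a,G^b)$ is one of the following triples, where $\mathbb Z_i$ is the cyclic group of order $i$ and $D_i$ the dihedral group of order $2i$: - $F$ trivial: $(G^a,G^b)=(\mathbb Z_2,\mathbb Z_2)$; - $F=\mathbb Z_2$: $(\mathbb Z_4,\mathbb Z_4)$, $(D_2,\mathbb Z_4)$ or $(D_2,D_2)$; - $F=\mathbb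 Z_3$: $(\mathbb Z_6,\mathbb Z_6)$, $(D_3,\mathbb Z_6)$ or $(D_3,D_3)$; - $F=\mathbb Z_4$: $(\mathbb Z_4\times\mathbb Z_2,\mathbb Z_4\times\mathbb Z_2)$, $(D_4,\mathbb Z_4\times\mathbb Z_2)$ or $(D_4,D_4)$; - $F=\mathbb Z_6$: $(\mathbb Z_6\times\mathbb Z_2,\mathbb Z_6\times\mathbb Z_2)$, $(D_6,\mathbb Z_6\times\mathbb Z_2)$ or $(D_6,D_6)$; - $F=D_2$: $(D_2\times\mathbb Z_2,D_2\times\mathbb Z_2)$, $(D_4,D_2\times\mathbb Z_2)$ or $(D_4,D_4)$; - $F=D_3$: $(D_3\times\mathbb Z_2,D_3\times\mathbb Z_2)$; - $F=D_4$: $(D_4\times\mathbb Z_2,D_4\times\mathbb Z_2)$; - $F=D_6$: $(D_6\times\mathbb Z_2,D_6\times\mathbb Z_2)$. -/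

import Mathlib

namespace Crystal

/-- Euclidean `n`-space `ℝⁿ`. -/
abbrev Space (n : ℕ) : Type := EuclideanSpace ℝ (Fin n)

/-- The group `O(n) ⋉ ℝⁿ` of affine isometries of `ℝⁿ`. -/
abbrev Isom (n : ℕ) : Type := Space n ≃ᵃⁱ[ℝ] Space n

/-- The tautological action of `O(n) ⋉ ℝⁿ` on `ℝⁿ`; every subgroup acts by restriction. -/
noncomputable instance isomMulAction (n : ℕ) : MulAction (Isom n) (Space n) where
  smul g x := g x
  one_smul _ := rfl
  mul_smul _ _ _ := rfl

/-- `G` acts cocompactly on `X ⊆ ℝⁿ`: the translates of some compact subset of `X` cover `X`. -/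
def ActsCocompactlyOn {n : ℕ} (G : Subgroup (Isom n)) (X : Set (Space n)) : Prop :=
  ∃ K ⊆ X, IsCompact K ∧ ∀ x ∈ X, ∃ g ∈ G, ∃ y ∈ K, g • y = x

/-- An `n`-crystallographic group: a group of isometries of `ℝⁿ` acting properly discontinuously
and cocompactly on `ℝⁿ`. -/
structure IsCrystallographic {n : ℕ} (Γ : Subgroup (Isom n)) : Prop where
  properlyDiscontinuous : ProperlyDiscontinuousSMul Γ (Space n)
  cocompact : ActsCocompactlyOn Γ Set.univ

/-- `l` is a line. -/
def IsLine {n : ℕ} (l : AffineSubspace ℝ (Space n)) : Prop :=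
  Module.finrank ℝ l.direction = 1

/-- `G` acts dihedrally (and cocompactly) on the line `l`: it leaves `l` invariant, it acts
cocompactly on `l`, and it does not act on `l` by translations only, that is, some element of `G`
restricts to the reflection of `l` about one of its points. (Every isometry of a line is either a
translation or such a reflection.) -/
structure ActsDihedrallyOn {n : ℕ} (G : Subgroup (Isom n)) (l : AffineSubspace ℝ (Space n)) :
    Prop where
  invariant : ∀ g ∈ G, (fun x => g • x) '' (l : Set (Space n)) = l
  cocompact : ActsCocompactlyOn G (l : Set (Space n))
  exists_reflection : ∃ g ∈ G, ∃ p ∈ l, ∀ x ∈ l, g • x = AffineEquiv.pointReflection ℝ p x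

/-- The subgroup `F` of all elements of `G` that fix `l` pointwise. -/
noncomputable abbrev pointwiseFixer {n : ℕ} (G : Subgroup (Isom n)) (l : AffineSubspace ℝ (Space n)) :
    Subgroup G :=
  fixingSubgroup G (l : Set (Space n))

/-- The isotropy group of the point `p` in `G`. -/
noncomputable abbrev isotropy {n : ℕ} (G : Subgroup (Isom n)) (p : Space n) : Subgroup G :=
  MulAction.stabilizer G p

theorem pointwiseFixer_le_isotropy {n : ℕ} (G : Subgroup (Isom n))
    (l : AffineSubspace ℝ (Space n)) (p : l) : pointwiseFixer G l ≤ isotropy G p :=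
  fun _ hg => hg p

/-- The amalgamated free product `G^{p 0} *_F G^{p 1}` of the isotropy groups of two points of `l`
over the pointwise fixer `F` of `l`, along the two inclusions. -/
abbrev IsotropyAmalgam {n : ℕ} (G : Subgroup (Isom n)) (l : AffineSubspace ℝ (Space n))
    (p : Fin 2 → l) : Type :=
  Monoid.PushoutI (H := pointwiseFixer G l) (G := fun i => isotropy G (p i))
    (fun i => Subgroup.inclusion (pointwiseFixer_le_isotropy G l (p i)))

/-- The canonical map of the isotropy group of `p i` into the amalgamated free product. -/
noncomputable def IsotropyAmalgam.of {n : ℕ} (G : Subgroup (Isom n)) (l : AffineSubspace ℝ (Space n))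
    (p : Fin 2 → l) (i : Fin 2) : isotropy G (p i) →* IsotropyAmalgam G l p :=
  Monoid.PushoutI.of (H := pointwiseFixer G l) (G := fun i => isotropy G (p i))
    (φ := fun i => Subgroup.inclusion (pointwiseFixer_le_isotropy G l (p i))) i

/-- Two groups are isomorphic. -/
def Iso (A B : Type) [Group A] [Group B] : Prop := Nonempty (A ≃* B)

/-- The cyclic group of order `i` (for `i ≠ 0`), written multiplicatively. -/
abbrev Z (i : ℕ) : Type := Multiplicative (ZMod i)

/-- The dihedral group of order `2 i` (for `i ≠ 0`). -/
abbrev D (i : ℕ) : Type := DihedralGroup i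

/-- The table of triples `(F, A, B)`, up to isomorphism of each of the three groups. -/
def DihedralTable (F A B : Type) [Group F] [Group A] [Group B] : Prop :=
  (Iso F Unit ∧ Iso A (Z 2) ∧ Iso B (Z 2)) ∨
  (Iso F (Z 2) ∧
    ((Iso A (Z 4) ∧ Iso B (Z 4)) ∨ (Iso A (D 2) ∧ Iso B (Z 4)) ∨ (Iso A (D 2) ∧ Iso B (D 2)))) ∨
  (Iso F (Z 3) ∧
    ((Iso A (Z 6) ∧ Iso B (Z 6)) ∨ (Iso A (D 3) ∧ Iso B (Z 6)) ∨ (Iso A (D 3) ∧ Iso B (D 3)))) ∨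
  (Iso F (Z 4) ∧
    ((Iso A (Z 4 × Z 2) ∧ Iso B (Z 4 × Z 2)) ∨ (Iso A (D 4) ∧ Iso B (Z 4 × Z 2)) ∨
      (Iso A (D 4) ∧ Iso B (D 4)))) ∨
  (Iso F (Z 6) ∧
    ((Iso A (Z 6 × Z 2) ∧ Iso B (Z 6 × Z 2)) ∨ (Iso A (D 6) ∧ Iso B (Z 6 × Z 2)) ∨
      (Iso A (D 6) ∧ Iso B (D 6)))) ∨
  (Iso F (D 2) ∧
    ((Iso A (D 2 × Z 2) ∧ Iso B (D 2 × Z 2)) ∨ (Iso A (D 4) ∧ Iso B (D 2 × Z 2)) ∨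
      (Iso A (D 4) ∧ Iso B (D 4)))) ∨
  (Iso F (D 3) ∧ Iso A (D 3 × Z 2) ∧ Iso B (D 3 × Z 2)) ∨
  (Iso F (D 4) ∧ Iso A (D 4 × Z 2) ∧ Iso B (D 4 × Z 2)) ∨
  (Iso F (D 6) ∧ Iso A (D 6 × Z 2) ∧ Iso B (D 6 × Z 2))

end Crystal

/-! Parametrize `l` by arc length. An element of `G` acts on `l` by `t ↦ c + σ t` with `σ = ±1`, and
on the orthogonal plane by an isometry `ψ`. Proper discontinuity makes the translation lengths along
`l` a discrete subgroup of `ℝ`, and cocompactness makes it nonzero, so it is `bℤ` with `b ≠ 0`. If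
`r` reflects `l` about `p` and `τ` translates it by `b`, then `τ r` reflects it about the point at
`b / 2`. Modulo `F`, these two reflections generate `G` as an infinite dihedral group `Z₂ * Z₂`, and
this lifts to the amalgam over `F` (`bijective_pushout_lift`).

The table is finite group theory. Since `ψ` is faithful on `F`, the group `F` is cyclic or dihedral
(`classification`). An isotropy group `H` of one of the two points contains `F` with index two.
Either `ψ` is faithful on `H`, which is then cyclic or dihedral too, or a nontrivial element of its
kernel splits off as a direct factor of order two (`IsDoubleExtension.injective_or_iso_prod`).
Comparing orders leaves the listed cases.

The rotation orders are 1, 2, 3, 4, 6 by the crystallographic restriction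
(`IsCrystallographic.pow_eq_one`), which needs a translation in `Γ` not parallel to `l`. It comes
from a Bieberbach-type commutator argument: elements with linear part close to the identity are
translations (`IsCrystallographic.lin_eq_one_of_nearId`), and cocompactness provides such elements
in every direction. -/

namespace Crystal
open scoped InnerProductSpace

/-! ### Linear parts and near-translations in a crystallographic group -/

section Lin
variable {n : ℕ}

/-- The linear part of an affine isometry. -/
noncomputable def lin : Isom n →* (Space n ≃ₗᵢ[ℝ] Space n) where
  toFun g := g.linearIsometryEquiv
  map_one' := rfl
  map_mul' _ _ := rfl

theorem smul_eq_apply (g : Isom n) (x : Space n) : g • x = g x := rfl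

theorem apply_eq_lin (g : Isom n) (x y : Space n) : g x = lin g (x - y) + g y := by
  have := g.map_vadd y (x - y)
  rw [vadd_eq_add, vadd_eq_add, sub_add_cancel] at this
  exact this

theorem apply_eq_lin_zero (g : Isom n) (x : Space n) : g x = lin g x + g 0 := by
  simpa using apply_eq_lin g x 0

theorem apply_sub_apply (g : Isom n) (x y : Space n) : g x - g y = lin g (x - y) := by
  rw [apply_eq_lin g x y, add_sub_cancel_right]

theorem inv_apply_self' (g : Isom n) (x : Space n) : g⁻¹ (g x) = x := g.symm_apply_apply x

theorem apply_inv_self' (g : Isom n) (x : Space n) : g (g⁻¹ x) = x := g.apply_symm_apply x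

theorem isom_ext_of_lin {g h : Isom n} (p : Space n) (h1 : lin g = lin h) (h2 : g p = h p) :
    g = h := by
  ext1 x
  rw [apply_eq_lin g x p, apply_eq_lin h x p, h1, h2]

theorem lin_inv_apply (g : Isom n) (x : Space n) : lin g (lin g⁻¹ x) = x := by
  have h : lin g * lin g⁻¹ = 1 := by rw [← map_mul, mul_inv_cancel, map_one]
  exact congrArg (fun A : Space n ≃ₗᵢ[ℝ] Space n => A x) h

theorem lin_inv_apply' (g : Isom n) (x : Space n) : lin g⁻¹ (lin g x) = x := by
  have h : lin g⁻¹ * lin g = 1 := by rw [← map_mul, inv_mul_cancel, map_one]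
  exact congrArg (fun A : Space n ≃ₗᵢ[ℝ] Space n => A x) h

theorem norm_inv_apply_zero (g : Isom n) : ‖g⁻¹ 0‖ = ‖g 0‖ := by
  have h := g.dist_map (g⁻¹ 0) 0
  rw [apply_inv_self', dist_zero_left, dist_zero_right] at h
  exact h.symm

theorem IsCrystallographic.finite_dist_le {Γ : Subgroup (Isom n)} (hΓ : IsCrystallographic Γ)
    (p q : Space n) (R : ℝ) : {g : Isom n | g ∈ Γ ∧ dist (g p) q ≤ R}.Finite := by
  have h := hΓ.properlyDiscontinuous.finite_disjoint_inter_image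
    (isCompact_singleton (x := p)) (isCompact_closedBall q R)
  refine (h.image (Subtype.val)).subset ?_
  rintro g ⟨hg, hd⟩
  exact ⟨⟨g, hg⟩, ⟨g p, ⟨p, rfl, rfl⟩, hd⟩, rfl⟩

/-- Only finitely many elements move the origin by a bounded amount. This supplies the minimal
counterexamples used below. -/
theorem IsCrystallographic.exists_norm_min {Γ : Subgroup (Isom n)} (hΓ : IsCrystallographic Γ)
    {P : Isom n → Prop} (hP : ∃ g ∈ Γ, P g) :
    ∃ g ∈ Γ, P g ∧ ∀ h ∈ Γ, P h → ‖g 0‖ ≤ ‖h 0‖ := by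
  obtain ⟨g₀, hg₀, hP₀⟩ := hP
  have hfin : {g : Isom n | g ∈ Γ ∧ P g ∧ ‖g 0‖ ≤ ‖g₀ 0‖}.Finite :=
    (hΓ.finite_dist_le 0 0 ‖g₀ 0‖).subset fun g hg => ⟨hg.1, by simpa using hg.2.2⟩
  obtain ⟨g, hg, hmin⟩ := Set.exists_min_image _ (fun g : Isom n => ‖g 0‖) hfin
    ⟨g₀, hg₀, hP₀, le_rfl⟩
  refine ⟨g, hg.1, hg.2.1, fun h hh hPh => ?_⟩
  by_cases hle : ‖h 0‖ ≤ ‖g₀ 0‖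
  · exact hmin h ⟨hh, hPh, hle⟩
  · exact hg.2.2.trans (le_of_not_ge hle)

/-- `A` moves every vector `x` by at most `m ‖x‖`. -/
def NearId (A : Space n ≃ₗᵢ[ℝ] Space n) (m : ℝ) : Prop := ∀ x, ‖A x - x‖ ≤ m * ‖x‖

theorem NearId.mono {A : Space n ≃ₗᵢ[ℝ] Space n} {m m' : ℝ} (h : NearId A m) (hm : m ≤ m') :
    NearId A m' := fun x => (h x).trans (by gcongr)

theorem exists_close_pair (A : ℕ → (Space n ≃ₗᵢ[ℝ] Space n)) {ε : ℝ} (hε : 0 < ε) :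
    ∃ i, ∀ N : ℕ, ∃ j ≥ N, ∀ x, ‖A j x - A i x‖ ≤ ε * ‖x‖ := by
  let L : ℕ → (Space n →L[ℝ] Space n) := fun k => (A k : Space n ≃L[ℝ] Space n)
  have hL : ∀ k, L k ∈ Metric.closedBall (0 : Space n →L[ℝ] Space n) 1 := fun k => by
    rw [mem_closedBall_zero_iff]
    exact ContinuousLinearMap.opNorm_le_bound _ zero_le_one fun x => by simp [L]
  obtain ⟨a, -, φ, hφ, hlim⟩ := (isCompact_closedBall (0 : Space n →L[ℝ] Space n) 1).tendsto_subseq hL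
  obtain ⟨N, hN⟩ := Metric.cauchySeq_iff.1 hlim.cauchySeq ε hε
  refine ⟨φ N, fun M => ⟨φ (max N M), ?_, fun x => ?_⟩⟩
  · exact (le_max_right N M).trans (hφ.id_le _)
  · have h := hN (max N M) (le_max_left _ _) N le_rfl
    rw [dist_eq_norm] at h
    have := (L (φ (max N M)) - L (φ N)).le_of_opNorm_le h.le x
    simpa [L] using this

/-- Cocompactness gives `γ k` moving `0` close to `k • u`. By compactness some fixed `i` has `lin (γ
j)` close to `lin (γ i)` for arbitrarily large `j`; take `γ j * (γ i)⁻¹`. As `i` is fixed, `C` does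
not depend on `N`. -/
theorem IsCrystallographic.exists_nearId_along {Γ : Subgroup (Isom n)} (hΓ : IsCrystallographic Γ)
    (u : Space n) {ε : ℝ} (hε : 0 < ε) :
    ∃ C : ℝ, ∀ N : ℕ, ∃ g ∈ Γ, ∃ j ≥ N, NearId (lin g) ε ∧ ‖g 0 - (j : ℝ) • u‖ ≤ C := by
  obtain ⟨K, -, hK, hcov⟩ := hΓ.cocompact
  obtain ⟨D, hD⟩ := hK.isBounded.exists_norm_le
  have hex : ∀ k : ℕ, ∃ g ∈ Γ, ‖g 0 - (k : ℝ) • u‖ ≤ D := fun k => by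
    obtain ⟨g, hg, y, hy, hgy⟩ := hcov ((k : ℝ) • u) trivial
    refine ⟨g, hg, ?_⟩
    rw [← hgy, smul_eq_apply, ← dist_eq_norm, g.dist_map, dist_zero_left]
    exact hD y hy
  choose γ hγ hγD using hex
  obtain ⟨i, hi⟩ := exists_close_pair (fun k => lin (γ k)) hε
  refine ⟨‖γ i 0‖ + D, fun N => ?_⟩
  obtain ⟨j, hj, hji⟩ := hi N
  refine ⟨γ j * (γ i)⁻¹, Γ.mul_mem (hγ j) (Γ.inv_mem (hγ i)), j, hj, fun x => ?_, ?_⟩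
  · have h := hji (lin (γ i)⁻¹ x)
    rw [lin_inv_apply, LinearIsometryEquiv.norm_map] at h
    simpa using h
  · have h1 : ‖γ j ((γ i)⁻¹ 0) - γ j 0‖ = ‖γ i 0‖ := by
      rw [apply_sub_apply, LinearIsometryEquiv.norm_map, sub_zero, norm_inv_apply_zero]
    calc ‖(γ j * (γ i)⁻¹) 0 - (j : ℝ) • u‖
        = ‖(γ j ((γ i)⁻¹ 0) - γ j 0) + (γ j 0 - (j : ℝ) • u)‖ := by
          congr 1; rw [sub_add_sub_cancel]; rfl
      _ ≤ _ := (norm_add_le _ _).trans (by rw [h1]; gcongr; exact hγD j)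

end Lin


/-! ### Complex coordinates orthogonal to an axis -/

/-- `J` identifies `ℂ` isometrically with the plane orthogonal to `u`. -/
def IsFrame (u : Space 3) (J : ℂ →ₗᵢ[ℝ] Space 3) : Prop :=
  ∀ x, ⟪u, x⟫_ℝ = 0 ↔ ∃ z, J z = x

theorem exists_isFrame {u : Space 3} (hu : ‖u‖ = 1) : ∃ J, IsFrame u J := by
  have hu0 : u ≠ 0 := by rintro rfl; simp at hu
  have : Fact (Module.finrank ℝ (Space 3) = 2 + 1) := ⟨by simp⟩
  let e : ℂ ≃ₗᵢ[ℝ] (ℝ ∙ u)ᗮ := Complex.orthonormalBasisOneI.equiv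
    (OrthonormalBasis.fromOrthogonalSpanSingleton 2 hu0) (Equiv.refl _)
  refine ⟨(ℝ ∙ u)ᗮ.subtypeₗᵢ.comp e.toLinearIsometry, fun x => ?_⟩
  rw [← Submodule.mem_orthogonal_singleton_iff_inner_right]
  constructor
  · intro hx
    exact ⟨e.symm ⟨x, hx⟩, by simp⟩
  · rintro ⟨z, rfl⟩
    exact (e z).2

section Frame
variable {u : Space 3} {J : ℂ →ₗᵢ[ℝ] Space 3}

theorem IsFrame.inner_eq_zero (hJ : IsFrame u J) (z : ℂ) : ⟪u, J z⟫_ℝ = 0 := (hJ _).2 ⟨z, rfl⟩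

theorem IsFrame.exists_decomp (hJ : IsFrame u J) (hu : ‖u‖ = 1) (x : Space 3) :
    ∃ z, x = ⟪u, x⟫_ℝ • u + J z := by
  obtain ⟨z, hz⟩ := (hJ (x - ⟪u, x⟫_ℝ • u)).1 (by
    rw [inner_sub_right, inner_smul_right, real_inner_self_eq_norm_sq, hu]; ring)
  exact ⟨z, by rw [hz]; abel⟩

theorem IsFrame.norm_sq (hJ : IsFrame u J) (hu : ‖u‖ = 1) (c : ℝ) (z : ℂ) :
    ‖c • u + J z‖ ^ 2 = c ^ 2 + ‖z‖ ^ 2 := by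
  rw [@norm_add_sq_real, inner_smul_left, hJ.inner_eq_zero, norm_smul, hu, J.norm_map]
  simp

theorem inner_map_of_map_eq {A : Space 3 ≃ₗᵢ[ℝ] Space 3} {s : ℝ} (hs : s ^ 2 = 1)
    (hA : A u = s • u) (x : Space 3) : ⟪u, A x⟫_ℝ = s * ⟪u, x⟫_ℝ := by
  have h := A.inner_map_map u x
  rw [hA, inner_smul_left] at h
  rw [← h]
  simp only [conj_trivial]
  linear_combination (-⟪u, A x⟫_ℝ) * hs

theorem IsFrame.exists_plane_isometry (hJ : IsFrame u J) {A : Space 3 ≃ₗᵢ[ℝ] Space 3} {s : ℝ}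
    (hs : s ^ 2 = 1) (hA : A u = s • u) :
    ∃ B : ℂ ≃ₗᵢ[ℝ] ℂ, ∀ z, A (J z) = J (B z) := by
  have hex : ∀ z, ∃ w, J w = A (J z) := fun z => (hJ _).1 (by
    rw [inner_map_of_map_eq hs hA, hJ.inner_eq_zero, mul_zero])
  choose f hf using hex
  let L : ℂ →ₗᵢ[ℝ] ℂ :=
    { toFun := f
      map_add' := fun x y => J.injective (by simp [hf])
      map_smul' := fun c x => J.injective (by
        change J (f (c • x)) = J (c • f x)
        rw [hf, J.map_smul, J.map_smul, A.map_smul, hf])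
      norm_map' := fun x => by
        change ‖f x‖ = ‖x‖
        rw [← J.norm_map, hf, A.norm_map, J.norm_map] }
  exact ⟨L.toLinearIsometryEquiv rfl, fun z => (hf z).symm⟩

end Frame

/-! ### Axes of linear isometries of 3-space -/

theorem det_adjoint_eq (f : Space 3 →ₗ[ℝ] Space 3) :
    LinearMap.det (LinearMap.adjoint f) = LinearMap.det f := by
  let b := EuclideanSpace.basisFun (Fin 3) ℝ
  rw [← LinearMap.det_toMatrix b.toBasis, ← LinearMap.det_toMatrix b.toBasis,
    LinearMap.toMatrix_adjoint, Matrix.det_conjTranspose]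
  simp

theorem exists_eigenvector (A : Space 3 ≃ₗᵢ[ℝ] Space 3) :
    (∃ v, ‖v‖ = 1 ∧ A v = v) ∨ ∃ v, ‖v‖ = 1 ∧ A v = -v := by
  let f : Space 3 →ₗ[ℝ] Space 3 := A.toLinearEquiv
  have hadj : f ∘ₗ LinearMap.adjoint f = LinearMap.id := by
    have : LinearMap.adjoint f = (A.symm.toLinearEquiv : Space 3 →ₗ[ℝ] Space 3) := by
      symm
      rw [LinearMap.eq_adjoint_iff]
      intro x y
      have := A.inner_map_map (A.symm x) y
      rw [A.apply_symm_apply] at this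
      exact this.symm
    rw [this]; ext1 x; exact A.apply_symm_apply x
  -- Since `f - c = -c f (f - c)ᵀ`, taking determinants in dimension 3 forces `det f = -c` when `c`
  -- is not an eigenvalue. This cannot hold for both `c = 1` and `c = -1`.
  have key : ∀ c : ℝ, c ^ 2 = 1 → LinearMap.det (f - c • LinearMap.id) ≠ 0 →
      LinearMap.det f = -c := by
    intro c hc h
    have h1 : f - c • LinearMap.id
        = (-c) • (f ∘ₗ (LinearMap.adjoint (f - c • LinearMap.id))) := by
      have h2 : LinearMap.adjoint (f - c • LinearMap.id)
          = LinearMap.adjoint f - c • LinearMap.id := by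
        rw [map_sub, LinearEquiv.map_smulₛₗ]; simp
      rw [h2, LinearMap.comp_sub, hadj, LinearMap.comp_smul, LinearMap.comp_id, smul_sub,
        smul_smul, ← sub_eq_zero]
      have : -c * c = -1 := by linear_combination -hc
      rw [this]; module
    have h3 := congrArg LinearMap.det h1
    rw [LinearMap.det_smul, LinearMap.det_comp, det_adjoint_eq] at h3
    have h4 : (-c) ^ 3 * LinearMap.det f = 1 := by
      have hfr : Module.finrank ℝ (Space 3) = 3 := by simp
      rw [hfr] at h3
      exact mul_right_cancel₀ h (by linear_combination -h3)
    have h5 : c ^ 4 = 1 := by linear_combination (c ^ 2 + 1) * hc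
    linear_combination (-c) * h4 - LinearMap.det f * h5
  have eig : ∀ c : ℝ, LinearMap.det (f - c • LinearMap.id) = 0 → ∃ v, ‖v‖ = 1 ∧ A v = c • v := by
    intro c h
    obtain ⟨v, hv, hv0⟩ := (Submodule.ne_bot_iff _).1 (LinearMap.bot_lt_ker_of_det_eq_zero h).ne'
    have hAv : A v = c • v := by
      have : A v - c • v = 0 := hv
      exact sub_eq_zero.1 this
    refine ⟨‖v‖⁻¹ • v, norm_smul_inv_norm hv0, ?_⟩
    rw [map_smul, hAv, smul_comm]
  by_cases h1 : LinearMap.det (f - (1 : ℝ) • LinearMap.id) = 0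
  · left; simpa using eig 1 h1
  · right
    by_cases h2 : LinearMap.det (f - (-1 : ℝ) • LinearMap.id) = 0
    · simpa using eig (-1) h2
    · have := key 1 (by norm_num) h1
      have := key (-1) (by norm_num) h2
      linarith

/-- The bound excludes the eigenvalue `-1`, so `A` has an axis. On the orthogonal plane a reflection
`z ↦ a * conj z` moves `1` and `I` by `‖a - 1‖` and `‖a + 1‖`, of sum at least 2, which is too much.
A rotation by `a` moves all plane vectors by the same factor `m = ‖a - 1‖`. -/
theorem NearId.exists_axis {A : Space 3 ≃ₗᵢ[ℝ] Space 3} (hA : NearId A (1 / 2)) (hne : A ≠ 1) :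
    ∃ v : Space 3, ∃ m : ℝ, ‖v‖ = 1 ∧ A v = v ∧ 0 < m ∧ m ≤ 1 / 2 ∧
      ∀ x, ⟪v, x⟫_ℝ = 0 → ‖A x - x‖ = m * ‖x‖ := by
  have hneg : ∀ v, A v = -v → v = 0 := fun v hv => by
    have := hA v
    rw [hv, ← neg_add', norm_neg, ← two_smul ℝ v, norm_smul] at this
    rw [← norm_eq_zero]
    norm_num at this
    linarith [norm_nonneg v]
  obtain ⟨v, hv1, hv⟩ : ∃ v, ‖v‖ = 1 ∧ A v = v := by
    refine (exists_eigenvector A).resolve_right ?_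
    rintro ⟨v, hv1, hv⟩
    rw [hneg v hv] at hv1
    simp at hv1
  obtain ⟨J, hJ⟩ := exists_isFrame hv1
  obtain ⟨B, hB⟩ := hJ.exists_plane_isometry (A := A) (s := 1) (by norm_num) (by simpa using hv)
  obtain ⟨a, ha | ha⟩ := linear_isometry_complex B
  · have hm : ∀ z, ‖A (J z) - J z‖ = ‖(a : ℂ) - 1‖ * ‖z‖ := fun z => by
      rw [hB, ← map_sub, J.norm_map, ← norm_mul, ha, rotation_apply]
      congr 1; ring
    refine ⟨v, ‖(a : ℂ) - 1‖, hv1, hv, ?_, ?_, fun x hx => ?_⟩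
    · rw [norm_pos_iff]
      intro h0
      apply hne
      ext1 x
      obtain ⟨z, hz⟩ := hJ.exists_decomp hv1 x
      have hz' := hm z
      rw [h0, norm_zero, zero_mul, norm_eq_zero, sub_eq_zero] at hz'
      rw [hz, map_add, map_smul, hv, hz']; rfl
    · have h1 := hA (J 1)
      rw [hm, J.norm_map] at h1
      simpa using h1
    · obtain ⟨z, rfl⟩ := (hJ x).1 hx
      rw [hm, J.norm_map]
  · exfalso
    have h1 := hA (J 1)
    have h2 := hA (J Complex.I)
    rw [hB, ← map_sub, J.norm_map, J.norm_map, ha] at h1 h2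
    simp only [LinearIsometryEquiv.trans_apply, Complex.conjLIE_apply, rotation_apply, map_one,
      mul_one, norm_one, Complex.conj_I, Complex.norm_I] at h1 h2
    have h3 : ‖(a : ℂ) * -Complex.I - Complex.I‖ = ‖(a : ℂ) + 1‖ := by
      rw [← mul_one ‖(a : ℂ) + 1‖, ← Complex.norm_I, ← norm_mul, ← norm_neg]
      congr 1; ring
    rw [h3] at h2
    have h4 := norm_sub_le ((a : ℂ) + 1) (a - 1)
    rw [show (a : ℂ) + 1 - (a - 1) = 2 by ring] at h4
    norm_num at h4
    linarith


/-! ### The commutator argument: near-translations are translations -/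

theorem commutator_apply_zero (α β : Isom 3) : (α * β * α⁻¹ * β⁻¹) 0 =
    (lin α (β 0) - β 0) + ((β 0 - lin (α * β * α⁻¹ * β⁻¹) (β 0)) +
      lin α (lin α⁻¹ (α 0) - lin β (lin α⁻¹ (α 0)))) := by
  have inv0 : ∀ g : Isom 3, g⁻¹ 0 = - lin g⁻¹ (g 0) := fun g => by
    have := apply_sub_apply g⁻¹ (g 0) 0
    rw [inv_apply_self', sub_zero] at this
    rw [← this, zero_sub, neg_neg]
  have lm : ∀ (g h : Isom 3) x, lin (g * h) x = lin g (lin h x) := fun g h x => by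
    rw [map_mul]; rfl
  have h1 : (α * β * α⁻¹ * β⁻¹) 0 = α (β (α⁻¹ (β⁻¹ 0))) := rfl
  have h2 : lin (α * β * α⁻¹ * β⁻¹) (β 0) = lin α (lin β (lin α⁻¹ (lin β⁻¹ (β 0)))) := by
    rw [lm, lm, lm]
  rw [h1, h2, apply_eq_lin_zero α (β _), apply_eq_lin_zero β (α⁻¹ _),
    apply_eq_lin_zero α⁻¹ (β⁻¹ _), inv0 β, inv0 α]
  simp only [map_add, map_sub, map_neg, lin_inv_apply]
  abel

theorem NearId.norm_sub_commutator {α β : Isom 3} {m ε : ℝ} (hα : NearId (lin α) m)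
    (hβ : NearId (lin β) ε) (hm : 0 ≤ m) (hε : 0 ≤ ε) : NearId (lin (α * β * α⁻¹ * β⁻¹)) (2 * (m * ε)) := by
  intro x
  have lm : ∀ (g h : Isom 3) x, lin (g * h) x = lin g (lin h x) := fun g h x => by
    rw [map_mul]; rfl
  set y := lin α⁻¹ (lin β⁻¹ x) with hy
  have hx : x = lin β (lin α y) := by rw [hy, lin_inv_apply, lin_inv_apply]
  have hnorm : ‖x‖ = ‖y‖ := by rw [hx, LinearIsometryEquiv.norm_map, LinearIsometryEquiv.norm_map]
  have h1 : lin (α * β * α⁻¹ * β⁻¹) x = lin α (lin β y) := by rw [lm, lm, lm]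
  -- The identity `αβ - βα = (α - 1)(β - 1) - (β - 1)(α - 1)`, applied to `y`.
  have h2 : lin (α * β * α⁻¹ * β⁻¹) x - x = (lin α (lin β y - y) - (lin β y - y)) -
      (lin β (lin α y - y) - (lin α y - y)) := by
    rw [h1, hx]; simp only [map_sub]; abel
  rw [h2, hnorm]
  calc _ ≤ ‖lin α (lin β y - y) - (lin β y - y)‖ + ‖lin β (lin α y - y) - (lin α y - y)‖ :=
        norm_sub_le _ _
    _ ≤ m * (ε * ‖y‖) + ε * (m * ‖y‖) := by
        gcongr
        · exact (hα _).trans (by gcongr; exact hβ y)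
        · exact (hβ _).trans (by gcongr; exact hα y)
    _ = _ := by ring

/-- There are elements of a crystallographic group which are nearly translations, in a direction
that is closer to the plane orthogonal to `v` than to `v`. -/
theorem IsCrystallographic.exists_nearId_transverse {Γ : Subgroup (Isom 3)}
    (hΓ : IsCrystallographic Γ) {v : Space 3} (hv : ‖v‖ = 1) {ε : ℝ} (hε : 0 < ε) :
    ∃ g ∈ Γ, NearId (lin g) ε ∧ 2 * ⟪v, g 0⟫_ℝ ^ 2 < ‖g 0‖ ^ 2 := by
  obtain ⟨J, hJ⟩ := exists_isFrame hv
  obtain ⟨C, hC⟩ := hΓ.exists_nearId_along (J 1) hε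
  obtain ⟨N, hN⟩ := exists_nat_gt (3 * C)
  obtain ⟨g, hg, j, hj, hnear, hgC⟩ := hC N
  refine ⟨g, hg, hnear, ?_⟩
  have hC0 : 0 ≤ C := (norm_nonneg _).trans hgC
  have hj' : (N : ℝ) ≤ j := by exact_mod_cast hj
  have h1 : ⟪v, g 0⟫_ℝ = ⟪v, g 0 - (j : ℝ) • J 1⟫_ℝ := by
    rw [inner_sub_right, inner_smul_right, hJ.inner_eq_zero]; ring
  have h2 : |⟪v, g 0⟫_ℝ| ≤ C := by
    rw [h1]
    exact (abs_real_inner_le_norm _ _).trans (by rw [hv, one_mul]; exact hgC)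
  have h3 : (j : ℝ) - C ≤ ‖g 0‖ := by
    have := norm_sub_norm_le ((j : ℝ) • J 1) (g 0)
    rw [norm_smul, J.norm_map, norm_one, mul_one, norm_sub_rev] at this
    simp only [Real.norm_natCast] at this
    linarith
  have h4 : 2 * C < ‖g 0‖ := by linarith
  have h5 : ⟪v, g 0⟫_ℝ ^ 2 ≤ C ^ 2 := sq_le_sq' (abs_le.1 h2).1 (abs_le.1 h2).2
  nlinarith

/-- Let `α` be a counterexample with shortest `α 0`, turning about `v` with displacement factor `m`,
and let `β` have shortest `β 0` among elements with linear part within `m / 8` of the identity and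
`β 0` transverse to `v`. The commutator `κ` belongs to the same class as `β`, but `κ 0 ≈ lin α (β 0)
- β 0` is shorter than `β 0`. -/
theorem IsCrystallographic.lin_eq_one_of_nearId {Γ : Subgroup (Isom 3)}
    (hΓ : IsCrystallographic Γ) {g : Isom 3} (hg : g ∈ Γ) (hnear : NearId (lin g) (1 / 2)) :
    lin g = 1 := by
  by_contra hne
  obtain ⟨α, hα, ⟨hαnear, hαne⟩, hαmin⟩ := hΓ.exists_norm_min
    (P := fun g => NearId (lin g) (1 / 2) ∧ lin g ≠ 1) ⟨g, hg, hnear, hne⟩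
  obtain ⟨v, m, hv, hαv, hm0, hm, hrot⟩ := hαnear.exists_axis hαne
  obtain ⟨β, hβ, ⟨hβnear, hβv⟩, hβmin⟩ := hΓ.exists_norm_min
    (P := fun g => NearId (lin g) (m / 8) ∧ 2 * ⟪v, g 0⟫_ℝ ^ 2 < ‖g 0‖ ^ 2)
    (hΓ.exists_nearId_transverse hv (by positivity))
  obtain ⟨J, hJ⟩ := exists_isFrame hv
  have hdec : ∀ x, ∃ z, ‖x‖ ^ 2 = ⟪v, x⟫_ℝ ^ 2 + ‖z‖ ^ 2 ∧ ‖lin α x - x‖ = m * ‖z‖ ∧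
      ⟪v, lin α x - x⟫_ℝ = 0 := fun x => by
    obtain ⟨z, hz⟩ := hJ.exists_decomp hv x
    refine ⟨z, ?_, ?_, ?_⟩
    · rw [← hJ.norm_sq hv, ← hz]
    · rw [← J.norm_map z, ← hrot _ (hJ.inner_eq_zero z), hz, map_add, map_smul, hαv,
        add_sub_add_left_eq_sub]
    · rw [inner_sub_right, inner_map_of_map_eq (s := 1) (by norm_num) (by simpa using hαv)]
      ring
  have hαm : NearId (lin α) m := fun x => by
    obtain ⟨z, h1, h2, -⟩ := hdec x
    rw [h2]
    gcongr
    exact le_of_sq_le_sq (by nlinarith [sq_nonneg ⟪v, x⟫_ℝ]) (norm_nonneg _)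
  obtain ⟨z, hbz, hd, hdv⟩ := hdec (β 0)
  set b := β 0 with hb
  set d := lin α b - b with hd_def
  set κ := α * β * α⁻¹ * β⁻¹ with hκ
  have hκΓ : κ ∈ Γ :=
    Γ.mul_mem (Γ.mul_mem (Γ.mul_mem hα hβ) (Γ.inv_mem hα)) (Γ.inv_mem hβ)
  have hκnear : NearId (lin κ) (2 * (m * (m / 8))) :=
    hαm.norm_sub_commutator hβnear hm0.le (by positivity)
  obtain ⟨r, hr⟩ : ∃ r, r = (b - lin κ b) +
      lin α (lin α⁻¹ (α 0) - lin β (lin α⁻¹ (α 0))) := ⟨_, rfl⟩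
  have hκ0 : κ 0 = d + r := by rw [hr]; exact commutator_apply_zero α β
  -- If `lin β = 1` the error vanishes. Otherwise `β` competes with `α`, so minimality bounds `‖α
  -- 0‖` by `‖b‖`.
  have hrle : ‖r‖ ≤ m / 4 * ‖b‖ := by
    by_cases hβ1 : lin β = 1
    · have hκ1 : lin κ = 1 := by
        rw [hκ]; simp only [map_mul, map_inv, hβ1]; group
      rw [hr, hκ1, hβ1]
      simp only [LinearIsometryEquiv.coe_one, id_eq, sub_self, map_zero, add_zero, norm_zero]
      positivity
    · have hab : ‖α 0‖ ≤ ‖b‖ := hαmin β hβ ⟨hβnear.mono (by linarith), hβ1⟩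
      have h1 : ‖b - lin κ b‖ ≤ 2 * (m * (m / 8)) * ‖b‖ := by
        rw [norm_sub_rev]; exact hκnear b
      have h2 : ‖lin α (lin α⁻¹ (α 0) - lin β (lin α⁻¹ (α 0)))‖ ≤ m / 8 * ‖b‖ := by
        rw [LinearIsometryEquiv.norm_map, norm_sub_rev]
        refine (hβnear _).trans ?_
        rw [LinearIsometryEquiv.norm_map]
        gcongr
      rw [hr]
      refine (norm_add_le _ _).trans ((add_le_add h1 h2).trans ?_)
      nlinarith [mul_nonneg hm0.le (norm_nonneg b)]
  have hb0 : 0 < ‖b‖ := by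
    rw [norm_pos_iff]
    intro h0
    rw [h0] at hβv
    simp at hβv
  have hzb : ‖z‖ ≤ ‖b‖ := le_of_sq_le_sq (by nlinarith [sq_nonneg ⟪v, b⟫_ℝ]) hb0.le
  -- Transversality gives `‖z‖² > ‖b‖² / 2`, and `7 / 10 < 1 / √2`. Below, `45 / 100 = 7 / 10 - 1 /
  -- 4`.
  have hbz' : 7 / 10 * ‖b‖ ≤ ‖z‖ := le_of_sq_le_sq (by nlinarith) (norm_nonneg _)
  have hmb : 0 < m * ‖b‖ := by positivity
  have hlt : ‖κ 0‖ < ‖b‖ := by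
    rw [hκ0]
    refine (norm_add_le _ _).trans_lt ?_
    rw [hd]
    nlinarith
  have hge : 45 / 100 * (m * ‖b‖) ≤ ‖κ 0‖ := by
    have h1 := norm_sub_norm_le d (-r)
    rw [sub_neg_eq_add, norm_neg, ← hκ0, hd] at h1
    nlinarith
  have hinner : ⟪v, κ 0⟫_ℝ ^ 2 ≤ (m / 4 * ‖b‖) ^ 2 := by
    rw [hκ0, inner_add_right, hdv, zero_add]
    have h1 : |⟪v, r⟫_ℝ| ≤ m / 4 * ‖b‖ :=
      (abs_real_inner_le_norm _ _).trans (by rw [hv, one_mul]; exact hrle)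
    exact sq_le_sq' (abs_le.1 h1).1 (abs_le.1 h1).2
  refine absurd (hβmin κ hκΓ ⟨hκnear.mono (by nlinarith), ?_⟩) (not_le.2 hlt)
  have h1 : (45 / 100 * (m * ‖b‖)) ^ 2 ≤ ‖κ 0‖ ^ 2 := by gcongr
  nlinarith

/-- A crystallographic group contains a translation that is not parallel to `v`. -/
theorem IsCrystallographic.exists_translation {Γ : Subgroup (Isom 3)}
    (hΓ : IsCrystallographic Γ) {v : Space 3} (hv : ‖v‖ = 1) :
    ∃ g ∈ Γ, lin g = 1 ∧ g 0 ≠ ⟪v, g 0⟫_ℝ • v := by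
  obtain ⟨g, hg, hnear, hlt⟩ := hΓ.exists_nearId_transverse hv (ε := 1 / 2) (by norm_num)
  refine ⟨g, hg, hΓ.lin_eq_one_of_nearId hg hnear, fun h => ?_⟩
  have h1 : ‖g 0‖ ^ 2 = ⟪v, g 0⟫_ℝ ^ 2 := by
    conv_lhs => rw [h]
    rw [norm_smul, hv, mul_one, Real.norm_eq_abs, sq_abs]
  nlinarith [sq_nonneg ⟪v, g 0⟫_ℝ]

/-! ### Crystallographic restriction -/

/-- The crystallographic restriction, for the elements whose linear part preserves the direction
of `u`. -/
theorem IsCrystallographic.pow_eq_one {Γ : Subgroup (Isom 3)} (hΓ : IsCrystallographic Γ)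
    {u : Space 3} {J : ℂ →ₗᵢ[ℝ] Space 3} (hu : ‖u‖ = 1) (hJ : IsFrame u J) {g : Isom 3}
    (hg : g ∈ Γ) {s : ℝ} (hs : s ^ 2 = 1) (hgu : lin g u = s • u) {a : Circle}
    (ha : ∀ z, lin g (J z) = J (a * z)) : a ^ 4 = 1 ∨ a ^ 6 = 1 := by
  obtain ⟨t, ht, ht1, htu⟩ := hΓ.exists_translation hu
  obtain ⟨z, hz⟩ := hJ.exists_decomp hu (t 0)
  have hz0 : z ≠ 0 := by
    rintro rfl
    exact htu (by simpa using hz)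
  have hconj : ∀ (h k : Isom 3), lin h = 1 → lin (k * h * k⁻¹) = 1 ∧
      (k * h * k⁻¹) 0 = lin k (h 0) := fun h k h1 => by
    refine ⟨by simp [h1], ?_⟩
    have h2 : h (k⁻¹ 0) = k⁻¹ 0 + h 0 := by
      rw [apply_eq_lin_zero h, h1]; rfl
    change k (h (k⁻¹ 0)) = _
    rw [h2, apply_eq_lin k _ (k⁻¹ 0), add_sub_cancel_left, apply_inv_self', add_zero]
  have hmul : ∀ (h k : Isom 3), lin h = 1 → (h * k) 0 = h 0 + k 0 := fun h k h1 => by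
    change h (k 0) = _
    rw [apply_eq_lin_zero h, h1, add_comm]; rfl
  have hinv : ∀ (h : Isom 3), lin h = 1 → h⁻¹ 0 = - h 0 := fun h h1 => by
    have := hmul h h⁻¹ h1
    rw [mul_inv_cancel] at this
    rw [eq_neg_iff_add_eq_zero, add_comm, ← this]; rfl
  -- The translations of `Γ` orthogonal to `u`; conjugation by `g` and `g⁻¹` makes `T` stable under
  -- `a` and `a⁻¹`.
  let T : AddSubgroup ℂ :=
    { carrier := {w | ∃ h ∈ Γ, lin h = 1 ∧ h 0 = J w}
      zero_mem' := ⟨1, Γ.one_mem, map_one _, by simp⟩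
      add_mem' := by
        rintro x y ⟨h, hh, h1, h0⟩ ⟨k, hk, k1, k0⟩
        exact ⟨h * k, Γ.mul_mem hh hk, by simp [h1, k1], by rw [hmul h k h1, h0, k0, map_add]⟩
      neg_mem' := by
        rintro x ⟨h, hh, h1, h0⟩
        exact ⟨h⁻¹, Γ.inv_mem hh, by simp [h1], by rw [hinv h h1, h0, map_neg]⟩ }
  have hTa : ∀ w ∈ T, (a : ℂ) * w ∈ T := by
    rintro w ⟨h, hh, h1, h0⟩
    obtain ⟨e1, e2⟩ := hconj h g h1
    exact ⟨_, Γ.mul_mem (Γ.mul_mem hg hh) (Γ.inv_mem hg), e1, by rw [e2, h0, ha]⟩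
  have hTa' : ∀ w ∈ T, (a : ℂ)⁻¹ * w ∈ T := by
    rintro w ⟨h, hh, h1, h0⟩
    obtain ⟨e1, e2⟩ := hconj h g⁻¹ h1
    refine ⟨_, Γ.mul_mem (Γ.mul_mem (Γ.inv_mem hg) hh) (Γ.inv_mem (Γ.inv_mem hg)), e1, ?_⟩
    rw [e2, h0, ← lin_inv_apply' g (J ((a : ℂ)⁻¹ * w)), ha, mul_inv_cancel_left₀ (by simp)]
  by_cases has : (a : ℂ) = s
  · left
    ext
    push_cast
    rw [has]
    exact_mod_cast (by linear_combination (s ^ 2 + 1) * hs : s ^ 4 = 1)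
  have hgt : lin g (t 0) - s • t 0 = J ((a - s) * z) := by
    have h1 : (s : ℂ) * z = s • z := (Complex.real_smul).symm
    rw [sub_mul, map_sub, ← ha, h1, J.map_smul, hz, map_add, map_smul, hgu, ← hz]
    conv_lhs => rw [hz]
    rw [smul_add, smul_comm, ← hz]
    abel
  -- The axial component of `t` cancels in `g t g⁻¹ t⁻ˢ`, leaving the planar vector `(a - s) * z`.
  have hne : ∃ h ∈ Γ, lin h = 1 ∧ ∃ w ≠ 0, h 0 = J w := by
    obtain ⟨e1, e2⟩ := hconj t g ht1
    have hgtΓ := Γ.mul_mem (Γ.mul_mem hg ht) (Γ.inv_mem hg)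
    have hw : ((a : ℂ) - s) * z ≠ 0 := mul_ne_zero (sub_ne_zero.2 has) hz0
    obtain rfl | rfl := sq_eq_sq_iff_eq_or_eq_neg.1 (show s ^ 2 = 1 ^ 2 by rw [hs, one_pow])
    · refine ⟨_, Γ.mul_mem hgtΓ (Γ.inv_mem ht), by rw [map_mul, e1, map_inv, ht1]; simp, _, hw, ?_⟩
      rw [hmul _ _ e1, e2, hinv t ht1, ← hgt]
      module
    · refine ⟨_, Γ.mul_mem hgtΓ ht, by rw [map_mul, e1, ht1]; simp, _, hw, ?_⟩
      rw [hmul _ _ e1, e2, ← hgt]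
      module
  obtain ⟨h, hh, ⟨h1, w, hw0, hw⟩, hmin⟩ := hΓ.exists_norm_min hne
  have hwT : w ∈ T := ⟨h, hh, h1, hw⟩
  set c : ℝ := 2 * (a : ℂ).re with hc
  have hac : (a : ℂ) + (a : ℂ)⁻¹ = c := by
    rw [← Circle.coe_inv, Circle.coe_inv_eq_conj, Complex.add_conj]
  have hcT : ((c : ℂ) - (round c : ℤ)) * w ∈ T := by
    rw [sub_mul, ← hac, add_mul, ← zsmul_eq_mul]
    exact T.sub_mem (T.add_mem (hTa w hwT) (hTa' w hwT)) (T.zsmul_mem hwT _)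
  -- `T` is stable under the real scalar `c = a + a⁻¹`. If `c` were not an integer, `c - round c`
  -- would shrink the shortest vector `w` by a factor at most `1 / 2`.
  have hck : c = round c := by
    by_contra hcne
    obtain ⟨k, hk, k1, k0⟩ := hcT
    have hle := hmin k hk ⟨k1, _, mul_ne_zero (sub_ne_zero.2 (by exact_mod_cast hcne)) hw0, k0⟩
    rw [hw, k0, J.norm_map, J.norm_map, norm_mul] at hle
    have h2 : ‖(c : ℂ) - (round c : ℤ)‖ ≤ 1 / 2 := by
      have : (c : ℂ) - (round c : ℤ) = ((c - round c : ℝ) : ℂ) := by push_cast; rfl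
      rw [this, Complex.norm_real]
      exact abs_sub_round c
    have h3 := norm_pos_iff.2 hw0
    nlinarith
  obtain ⟨k, hk⟩ : ∃ k : ℤ, c = k := ⟨_, hck⟩
  have hre : |(a : ℂ).re| ≤ 1 := (Complex.abs_re_le_norm _).trans (Circle.norm_coe a).le
  rw [abs_le] at hre
  have hk2 : k ≤ 2 := by exact_mod_cast (by linarith : (k : ℝ) ≤ 2)
  have hk2' : -2 ≤ k := by exact_mod_cast (by linarith : (-2 : ℝ) ≤ k)
  have hquad : (a : ℂ) ^ 2 - k * a + 1 = 0 := by
    have h0 : (a : ℂ) ≠ 0 := by simp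
    have : (a : ℂ) + (a : ℂ)⁻¹ = k := by rw [hac, hk]; simp
    field_simp at this
    linear_combination this
  -- For `k = -2, …, 2` the quadratic is `(x + 1)²`, `Φ₃`, `Φ₄`, `Φ₆`, `(x - 1)²`.
  have key : (a : ℂ) ^ 4 = 1 ∨ (a : ℂ) ^ 6 = 1 := by
    generalize (a : ℂ) = x at hquad
    interval_cases k <;> push_cast at hquad
    · left
      have : x + 1 = 0 := pow_eq_zero_iff (two_ne_zero) |>.1 (by linear_combination hquad)
      rw [eq_neg_of_add_eq_zero_left this]; norm_num
    · right; linear_combination (x ^ 4 - x ^ 3 + x - 1) * hquad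
    · left; linear_combination (x ^ 2 - 1) * hquad
    · right; linear_combination (x ^ 4 + x ^ 3 - x - 1) * hquad
    · left
      have : x - 1 = 0 := pow_eq_zero_iff (two_ne_zero) |>.1 (by linear_combination hquad)
      rw [sub_eq_zero.1 this]; norm_num
  refine key.imp (fun h => ?_) (fun h => ?_) <;> · ext; push_cast; exact h


/-! ### Finite groups of plane isometries and the table -/

section Groups
variable {F H A B : Type} [Group F] [Group H] [Group A] [Group B]

theorem Iso.symm (h : Iso A B) : Iso B A := h.map MulEquiv.symm

theorem Iso.trans (h : Iso A H) (h' : Iso H B) : Iso A B :=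
  h.elim fun e => h'.map fun e' => e.trans e'

theorem Iso.prod_right (h : Iso A B) : Iso (A × H) (B × H) :=
  h.map fun e => e.prodCongr (MulEquiv.refl H)

theorem Iso.natCard_eq (h : Iso A B) : Nat.card A = Nat.card B :=
  h.elim fun e => Nat.card_congr e.toEquiv

theorem iso_Z_one : Iso (Z 1) Unit :=
  ⟨{ toFun := fun _ => (), invFun := fun _ => 1, left_inv := by decide, right_inv := by decide,
     map_mul' := by decide }⟩

theorem iso_D_one : Iso (D 1) (Z 2) :=
  ⟨MulEquiv.ofBijective
    (MonoidHom.mk' (fun x : D 1 => match x with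
      | .r _ => (Multiplicative.ofAdd 0 : Z 2)
      | .sr _ => Multiplicative.ofAdd 1) (by decide)) (by decide)⟩

theorem iso_Z_two_prod : Iso (Z 2 × Z 2) (D 2) :=
  Iso.symm ⟨MulEquiv.ofBijective
    (MonoidHom.mk' (fun x : D 2 => match x with
      | .r i => ((Multiplicative.ofAdd i, Multiplicative.ofAdd 0) : Z 2 × Z 2)
      | .sr i => (Multiplicative.ofAdd i, Multiplicative.ofAdd 1)) (by decide)) (by decide)⟩

theorem iso_Z_three_prod : Iso (Z 3 × Z 2) (Z 6) :=
  Iso.symm ⟨MulEquiv.ofBijective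
    (MonoidHom.mk' (fun x : Z 6 =>
      ((Multiplicative.ofAdd x.toAdd.cast, Multiplicative.ofAdd x.toAdd.cast) : Z 3 × Z 2))
      (by decide)) (by decide)⟩

set_option maxRecDepth 4000 in
theorem iso_D_three_prod : Iso (D 3 × Z 2) (D 6) :=
  Iso.symm ⟨MulEquiv.ofBijective
    (MonoidHom.mk' (fun x : D 6 => match x with
      | .r i => ((.r i.cast, Multiplicative.ofAdd i.cast) : D 3 × Z 2)
      | .sr i => (.sr i.cast, Multiplicative.ofAdd i.cast)) (by decide)) (by decide)⟩

theorem iso_D_of_cyclic {R : Subgroup H} {n : ℕ} (e : Z n ≃* R) {s : H} (hs : s ∉ R)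
    (hss : s * s = 1) (hinv : ∀ x ∈ R, x * s = s * x⁻¹) (hcov : ∀ h, h ∉ R → s * h ∈ R) :
    Iso H (D n) := by
  let E : ZMod n → H := fun i => e (Multiplicative.ofAdd i)
  have hE : ∀ i j, E (i + j) = E i * E j := fun i j => by simp [E]
  have hEn : ∀ i, E (-i) = (E i)⁻¹ := fun i => by simp [E]
  have hEi : ∀ i j, E i = E j → i = j := fun i j h =>
    Multiplicative.ofAdd.injective (e.injective (Subtype.ext h))
  have hER : ∀ i, E i ∈ R := fun i => (e _).2
  have hEs : ∀ x ∈ R, ∃ i, E i = x := fun x hx =>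
    ⟨(e.symm ⟨x, hx⟩).toAdd, by simp [E]⟩
  let f : D n → H := fun x => match x with
    | .r i => E i
    | .sr i => s * E i
  have hmul : ∀ x y, f (x * y) = f x * f y := by
    rintro (i | i) (j | j)
    · exact hE i j
    · change s * E (j - i) = E i * (s * E j)
      rw [← mul_assoc, hinv _ (hER i), mul_assoc, ← hEn, ← hE]
      congr 2; ring
    · change s * E (i + j) = s * E i * E j
      rw [hE, mul_assoc]
    · change E (j - i) = s * E i * (s * E j)
      rw [mul_assoc, ← mul_assoc (E i), hinv _ (hER i), mul_assoc, ← mul_assoc s, hss, one_mul,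
        ← hEn, ← hE]
      congr 1; ring
  refine Iso.symm ⟨MulEquiv.ofBijective (MonoidHom.mk' f hmul) ⟨?_, fun h => ?_⟩⟩
  · have aux : ∀ i j, E i ≠ s * E j := fun i j h => hs (by
      rw [eq_mul_inv_of_mul_eq h.symm]
      exact R.mul_mem (hER i) (R.inv_mem (hER j)))
    rintro (i | i) (j | j) h
    · exact congrArg _ (hEi i j h)
    · exact (aux i j h).elim
    · exact (aux j i h.symm).elim
    · exact congrArg _ (hEi i j (mul_left_cancel h))
  · by_cases hh : h ∈ R
    · obtain ⟨i, hi⟩ := hEs h hh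
      exact ⟨.r i, hi⟩
    · obtain ⟨i, hi⟩ := hEs _ (hcov h hh)
      refine ⟨.sr i, ?_⟩
      change s * E i = h
      rw [hi, ← mul_assoc, hss, one_mul]

/-- The elements that act as rotations. -/
noncomputable def rotations (ψ : H →* (ℂ ≃ₗᵢ[ℝ] ℂ)) : Subgroup H := rotation.range.comap ψ

theorem exists_of_not_mem_rotations {ψ : H →* (ℂ ≃ₗᵢ[ℝ] ℂ)} {h : H} (hh : h ∉ rotations ψ) :
    ∃ a : Circle, ∀ z, ψ h z = a * (starRingEnd ℂ) z := by
  obtain ⟨a, ha | ha⟩ := linear_isometry_complex (ψ h)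
  · exact (hh ⟨a, ha.symm⟩).elim
  · exact ⟨a, fun z => by rw [ha]; rfl⟩

/-- The crystallographic restriction on the rotations in a group of isometries of the plane. -/
def IsRestricted (ψ : H →* (ℂ ≃ₗᵢ[ℝ] ℂ)) : Prop :=
  ∀ h a, ψ h = rotation a → a ^ 4 = 1 ∨ a ^ 6 = 1

/-- The possible orders of crystallographic rotations. -/
def CrystalOrder (n : ℕ) : Prop := n = 1 ∨ n = 2 ∨ n = 3 ∨ n = 4 ∨ n = 6

theorem crystalOrder_of_dvd {n : ℕ} (h : n ∣ 4 ∨ n ∣ 6) : CrystalOrder n := by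
  have hn : n ≤ 6 := h.elim (fun h => (Nat.le_of_dvd (by norm_num) h).trans (by norm_num))
    (Nat.le_of_dvd (by norm_num))
  unfold CrystalOrder
  interval_cases n <;> revert h <;> decide

/-- The rotations embed in the multiplicative monoid of the field `ℂ`, so they form a cyclic group;
its order divides 4 or 6 by the restriction applied to a generator. -/
theorem exists_iso_rotations [Finite H] {ψ : H →* (ℂ ≃ₗᵢ[ℝ] ℂ)} (hψ : Function.Injective ψ)
    (hres : IsRestricted ψ) : ∃ n, CrystalOrder n ∧ Iso (Z n) (rotations ψ) := by
  let f : rotations ψ →* ℂ := Circle.coeHom.comp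
    ((MonoidHom.ofInjective rotation_injective).symm.toMonoidHom.comp
      (ψ.subgroupComap rotation.range))
  have hf : Function.Injective f := by
    refine Circle.coe_injective.comp ((MulEquiv.injective (MonoidHom.ofInjective
      rotation_injective).symm).comp (f := ψ.subgroupComap rotation.range) fun x y h => ?_)
    exact Subtype.ext (hψ (congrArg Subtype.val h))
  have hcyc : IsCyclic (rotations ψ) := isCyclic_of_injective_ringHom f hf
  obtain ⟨r, hr⟩ := hcyc.exists_ofOrder_eq_natCard
  refine ⟨Nat.card (rotations ψ), ?_, ⟨zmodCyclicMulEquiv hcyc⟩⟩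
  rw [← hr]
  obtain ⟨a, ha⟩ := r.2
  have key : ∀ k, a ^ k = 1 → orderOf r ∣ k := fun k hk => by
    rw [orderOf_dvd_iff_pow_eq_one]
    apply Subtype.ext
    apply hψ
    push_cast
    rw [map_pow, ← ha, ← map_pow, hk, map_one, map_one]
  exact crystalOrder_of_dvd ((hres r a ha.symm).imp (key 4) (key 6))

/-- A reflection is an involution that inverts every rotation, and the product of two reflections is
a rotation. -/
theorem classification [Finite H] {ψ : H →* (ℂ ≃ₗᵢ[ℝ] ℂ)} (hψ : Function.Injective ψ)
    (hres : IsRestricted ψ) : ∃ n, CrystalOrder n ∧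
      ((rotations ψ = ⊤ ∧ Iso H (Z n)) ∨ (rotations ψ ≠ ⊤ ∧ Iso H (D n))) := by
  obtain ⟨n, hn, ⟨e⟩⟩ := exists_iso_rotations hψ hres
  refine ⟨n, hn, ?_⟩
  by_cases htop : rotations ψ = ⊤
  · left
    refine ⟨htop, ⟨MulEquiv.symm (e.trans ?_)⟩⟩
    rw [htop]
    exact Subgroup.topEquiv
  · right
    refine ⟨htop, ?_⟩
    obtain ⟨s, hs⟩ : ∃ s, s ∉ rotations ψ := by
      by_contra! h
      exact htop (eq_top_iff.2 fun x _ => h x)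
    obtain ⟨a, ha⟩ := exists_of_not_mem_rotations hs
    have hm : ∀ (x y : H) z, ψ (x * y) z = ψ x (ψ y z) := fun x y z => by rw [map_mul]; rfl
    have haa : (a : ℂ) * (starRingEnd ℂ) a = 1 := by
      rw [Complex.mul_conj, Circle.normSq_coe]; simp
    refine iso_D_of_cyclic e hs ?_ ?_ ?_
    · apply hψ
      ext1 z
      rw [hm, ha, ha, map_one, map_mul, Complex.conj_conj, ← mul_assoc, haa, one_mul]
      rfl
    · rintro x ⟨b, hb⟩
      apply hψ
      ext1 z
      rw [hm, hm, ha, ha, map_inv, ← hb, ← map_inv, rotation_apply, rotation_apply, map_mul,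
        ← Circle.coe_inv_eq_conj, inv_inv]
      ring
    · intro h hh
      obtain ⟨b, hb⟩ := exists_of_not_mem_rotations hh
      refine ⟨a * b⁻¹, ?_⟩
      ext1 z
      rw [hm, ha, hb, rotation_apply, map_mul, Complex.conj_conj, Circle.coe_mul,
        Circle.coe_inv_eq_conj, mul_assoc]

/-- `H` is an extension of `F` by a group of order two, acting on the plane through `ψ` and on a
line through `σ`, such that `F` is the kernel of `σ`. -/
structure IsDoubleExtension (ι : F →* H) (σ : H →* ℤˣ) (ψ : H →* (ℂ ≃ₗᵢ[ℝ] ℂ)) : Prop where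
  injective : Function.Injective ι
  exact : ∀ h, σ h = 1 ↔ ∃ f, ι f = h
  exists_neg : ∃ h, σ h = -1
  faithful : ∀ h, σ h = 1 → ψ h = 1 → h = 1
  restricted : IsRestricted ψ

namespace IsDoubleExtension
variable {ι : F →* H} {σ : H →* ℤˣ} {ψ : H →* (ℂ ≃ₗᵢ[ℝ] ℂ)}

/-- A nontrivial `c` in the kernel of `ψ` has `σ c = -1`. Its square and its commutators lie in both
kernels, hence are trivial, so `c` is a central involution complementing `F`. -/
theorem injective_or_iso_prod (h : IsDoubleExtension ι σ ψ) :
    Function.Injective ψ ∨ Iso H (F × Z 2) := by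
  by_cases hinj : Function.Injective ψ
  · exact Or.inl hinj
  right
  obtain ⟨c, hc, hc1⟩ : ∃ c, ψ c = 1 ∧ c ≠ 1 := by
    by_contra! hcon
    exact hinj ((injective_iff_map_eq_one ψ).2 hcon)
  have hcσ : σ c = -1 := (Int.units_eq_one_or (σ c)).resolve_left fun h1 =>
    hc1 (h.faithful c h1 hc)
  have hcc : c * c = 1 := h.faithful _ (by rw [map_mul, hcσ]; rfl) (by rw [map_mul, hc, one_mul])
  have hcomm : ∀ x, x * c = c * x := fun x => by
    have : x * c * x⁻¹ * c⁻¹ = 1 := h.faithful _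
      (by simp only [map_mul, map_inv]; rw [mul_right_comm (σ x)]; simp)
      (by simp [hc])
    rwa [mul_inv_eq_one, mul_inv_eq_iff_eq_mul] at this
  let g : Z 2 → H := fun k => if k = 1 then 1 else c
  have h2 : ∀ k : Z 2, k = 1 ∨ k = Multiplicative.ofAdd 1 := by decide
  have hne : (Multiplicative.ofAdd 1 : Z 2) ≠ 1 := by decide
  have hg1 : g 1 = 1 := if_pos rfl
  have hgc : g (Multiplicative.ofAdd 1) = c := if_neg hne
  have hgm : ∀ k l, g (k * l) = g k * g l := by
    intro k l
    rcases h2 k with rfl | rfl <;> rcases h2 l with rfl | rfl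
    · simp [hg1]
    · simp [hg1]
    · simp [hg1]
    · rw [hgc, hcc, ← hg1]; rfl
  have hgcomm : ∀ k x, x * g k = g k * x := by
    intro k x
    rcases h2 k with rfl | rfl
    · simp [hg1]
    · rw [hgc, hcomm]
  have hισ : ∀ f, σ (ι f) = 1 := fun f => (h.exact _).2 ⟨f, rfl⟩
  refine Iso.symm ⟨MulEquiv.ofBijective (MonoidHom.mk' (fun x : F × Z 2 => ι x.1 * g x.2) ?_)
    ⟨?_, ?_⟩⟩
  · rintro ⟨f, k⟩ ⟨f', k'⟩
    change ι (f * f') * g (k * k') = ι f * g k * (ι f' * g k')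
    rw [map_mul, hgm, mul_assoc, mul_assoc, ← mul_assoc (g k) (ι f'), ← hgcomm k (ι f'), mul_assoc]
  · rw [injective_iff_map_eq_one]
    rintro ⟨f, k⟩ hfk
    change ι f * g k = 1 at hfk
    rcases h2 k with rfl | rfl
    · rw [hg1, mul_one] at hfk
      rw [(map_eq_one_iff ι h.injective).1 hfk]; rfl
    · exfalso
      have := congrArg σ hfk
      rw [map_mul, hισ, hgc, hcσ, map_one] at this
      exact absurd this (by decide)
  · intro x
    rcases Int.units_eq_one_or (σ x) with h1 | h1
    · obtain ⟨f, rfl⟩ := (h.exact x).1 h1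
      exact ⟨(f, 1), by change ι f * g 1 = _; rw [hg1, mul_one]⟩
    · obtain ⟨f, hf⟩ := (h.exact (x * c)).1 (by rw [map_mul, h1, hcσ]; rfl)
      refine ⟨(f, Multiplicative.ofAdd 1), ?_⟩
      change ι f * g (Multiplicative.ofAdd 1) = _
      rw [hgc, hf, mul_assoc, hcc, mul_one]

theorem natCard_eq (h : IsDoubleExtension ι σ ψ) : Nat.card H = 2 * Nat.card F := by
  have h1 : Nat.card σ.ker = Nat.card F := by
    refine (Nat.card_congr ((MonoidHom.ofInjective h.injective).toEquiv.trans
      (Equiv.setCongr ?_))).symm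
    ext x
    exact (h.exact x).symm
  have h2 : σ.ker.index = 2 := by
    rw [Subgroup.index_ker]
    have : σ.range = ⊤ := by
      obtain ⟨c, hc⟩ := h.exists_neg
      rw [eq_top_iff]
      intro x _
      rcases Int.units_eq_one_or x with rfl | rfl
      · exact one_mem _
      · exact ⟨c, hc⟩
    rw [this]
    simp
  rw [← σ.ker.card_mul_index, h1, h2, mul_comm]

theorem finite [Finite F] (h : IsDoubleExtension ι σ ψ) : Finite H := by
  apply Nat.finite_of_card_ne_zero
  rw [h.natCard_eq]
  have := Nat.card_pos (α := F)
  omega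

theorem natCard_Z {n : ℕ} : Nat.card (Z n) = n := Nat.card_zmod n

theorem cyclic_options [Finite F] (h : IsDoubleExtension ι σ ψ) {n : ℕ} (hF : Iso F (Z n)) :
    (CrystalOrder (2 * n) ∧ Iso H (Z (2 * n))) ∨ Iso H (D n) ∨ Iso H (Z n × Z 2) := by
  have := h.finite
  have hcard := h.natCard_eq
  rw [hF.natCard_eq, natCard_Z] at hcard
  rcases h.injective_or_iso_prod with hinj | hiso
  · obtain ⟨m, hm, ⟨-, hH⟩ | ⟨-, hH⟩⟩ := classification hinj h.restricted
    · rw [hH.natCard_eq, natCard_Z] at hcard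
      subst hcard
      exact Or.inl ⟨hm, hH⟩
    · rw [hH.natCard_eq, DihedralGroup.nat_card] at hcard
      obtain rfl : m = n := by omega
      exact Or.inr (Or.inl hH)
  · exact Or.inr (Or.inr (hiso.trans hF.prod_right))

/-- A reflection in the image of `F` (`hrot`) prevents `H` from consisting of rotations; this is
visible in the action, but not in the isomorphism type when `n = 1`. -/
theorem dihedral_options [Finite F] (h : IsDoubleExtension ι σ ψ) {n : ℕ} (hF : Iso F (D n))
    (hrot : rotations (ψ.comp ι) ≠ ⊤) :
    (CrystalOrder (2 * n) ∧ Iso H (D (2 * n))) ∨ Iso H (D n × Z 2) := by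
  have := h.finite
  have hcard := h.natCard_eq
  rw [hF.natCard_eq, DihedralGroup.nat_card] at hcard
  rcases h.injective_or_iso_prod with hinj | hiso
  · obtain ⟨m, hm, ⟨htop, -⟩ | ⟨-, hH⟩⟩ := classification hinj h.restricted
    · refine absurd (eq_top_iff.2 fun x _ => ?_) hrot
      have : ι x ∈ rotations ψ := htop ▸ Subgroup.mem_top _
      exact this
    · rw [hH.natCard_eq, DihedralGroup.nat_card] at hcard
      obtain rfl : m = 2 * n := by omega
      exact Or.inl ⟨hm, hH⟩
  · exact Or.inr (hiso.trans hF.prod_right)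

theorem faithful_comp (h : IsDoubleExtension ι σ ψ) : Function.Injective (ψ.comp ι) := by
  rw [injective_iff_map_eq_one]
  intro f hf
  exact (map_eq_one_iff ι h.injective).1 (h.faithful _ ((h.exact _).2 ⟨f, rfl⟩) hf)

end IsDoubleExtension

theorem pair_or_swap {p q p' q' : Prop} (h : p ∨ q) (h' : p' ∨ q') :
    ((p ∧ p') ∨ (q ∧ p') ∨ (q ∧ q')) ∨ ((p' ∧ p) ∨ (q' ∧ p) ∨ (q' ∧ q)) := by
  tauto

/-- The table lists each mixed pair in one order only, hence the swap. The hypothesis `hψ` lets one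
classification of `F` serve both sides. -/
theorem dihedralTable_or_swap [Finite F] {ιA : F →* A} {σA : A →* ℤˣ}
    {ψA : A →* (ℂ ≃ₗᵢ[ℝ] ℂ)} {ιB : F →* B} {σB : B →* ℤˣ} {ψB : B →* (ℂ ≃ₗᵢ[ℝ] ℂ)}
    (hA : IsDoubleExtension ιA σA ψA) (hB : IsDoubleExtension ιB σB ψB)
    (hψ : ψA.comp ιA = ψB.comp ιB) : DihedralTable F A B ∨ DihedralTable F B A := by
  obtain ⟨n, hn, ⟨-, hF⟩ | ⟨hrot, hF⟩⟩ := classification hA.faithful_comp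
    (fun f a hfa => hA.restricted (ιA f) a hfa)
  · have oA := hA.cyclic_options hF
    have oB := hB.cyclic_options hF
    rcases hn with rfl | rfl | rfl | rfl | rfl
    · have red : ∀ {H : Type} [Group H], (CrystalOrder (2 * 1) ∧ Iso H (Z (2 * 1))) ∨
          Iso H (D 1) ∨ Iso H (Z 1 × Z 2) → Iso H (Z 2) := by
        rintro H _ (⟨-, h⟩ | h | h)
        · exact h
        · exact h.trans iso_D_one
        · exact h.trans (iso_Z_one.prod_right.trans ⟨MulEquiv.uniqueProd⟩)
      exact Or.inl (Or.inl ⟨hF.trans iso_Z_one, red oA, red oB⟩)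
    · have red : ∀ {H : Type} [Group H], (CrystalOrder (2 * 2) ∧ Iso H (Z (2 * 2))) ∨
          Iso H (D 2) ∨ Iso H (Z 2 × Z 2) → Iso H (Z 4) ∨ Iso H (D 2) := by
        rintro H _ (⟨-, h⟩ | h | h)
        · exact Or.inl h
        · exact Or.inr h
        · exact Or.inr (h.trans iso_Z_two_prod)
      exact (pair_or_swap (red oA) (red oB)).imp (fun t => Or.inr (Or.inl ⟨hF, t⟩))
        (fun t => Or.inr (Or.inl ⟨hF, t⟩))
    · have red : ∀ {H : Type} [Group H], (CrystalOrder (2 * 3) ∧ Iso H (Z (2 * 3))) ∨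
          Iso H (D 3) ∨ Iso H (Z 3 × Z 2) → Iso H (Z 6) ∨ Iso H (D 3) := by
        rintro H _ (⟨-, h⟩ | h | h)
        · exact Or.inl h
        · exact Or.inr h
        · exact Or.inl (h.trans iso_Z_three_prod)
      exact (pair_or_swap (red oA) (red oB)).imp (fun t => Or.inr (Or.inr (Or.inl ⟨hF, t⟩)))
        (fun t => Or.inr (Or.inr (Or.inl ⟨hF, t⟩)))
    · have hno : ¬ CrystalOrder (2 * 4) := by unfold CrystalOrder; decide
      have red : ∀ {H : Type} [Group H], (CrystalOrder (2 * 4) ∧ Iso H (Z (2 * 4))) ∨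
          Iso H (D 4) ∨ Iso H (Z 4 × Z 2) → Iso H (Z 4 × Z 2) ∨ Iso H (D 4) :=
        fun h => (h.resolve_left fun h' => hno h'.1).symm
      exact (pair_or_swap (red oA) (red oB)).imp
        (fun t => Or.inr (Or.inr (Or.inr (Or.inl ⟨hF, t⟩))))
        (fun t => Or.inr (Or.inr (Or.inr (Or.inl ⟨hF, t⟩))))
    · have hno : ¬ CrystalOrder (2 * 6) := by unfold CrystalOrder; decide
      have red : ∀ {H : Type} [Group H], (CrystalOrder (2 * 6) ∧ Iso H (Z (2 * 6))) ∨
          Iso H (D 6) ∨ Iso H (Z 6 × Z 2) → Iso H (Z 6 × Z 2) ∨ Iso H (D 6) :=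
        fun h => (h.resolve_left fun h' => hno h'.1).symm
      exact (pair_or_swap (red oA) (red oB)).imp
        (fun t => Or.inr (Or.inr (Or.inr (Or.inr (Or.inl ⟨hF, t⟩)))))
        (fun t => Or.inr (Or.inr (Or.inr (Or.inr (Or.inl ⟨hF, t⟩)))))
  · have oA := hA.dihedral_options hF hrot
    have oB := hB.dihedral_options hF (hψ ▸ hrot)
    rcases hn with rfl | rfl | rfl | rfl | rfl
    · have red : ∀ {H : Type} [Group H], (CrystalOrder (2 * 1) ∧ Iso H (D (2 * 1))) ∨
          Iso H (D 1 × Z 2) → Iso H (Z 4) ∨ Iso H (D 2) := by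
        rintro H _ (⟨-, h⟩ | h)
        · exact Or.inr h
        · exact Or.inr (h.trans (iso_D_one.prod_right.trans iso_Z_two_prod))
      exact (pair_or_swap (red oA) (red oB)).imp
        (fun t => Or.inr (Or.inl ⟨hF.trans iso_D_one, t⟩))
        (fun t => Or.inr (Or.inl ⟨hF.trans iso_D_one, t⟩))
    · have red : ∀ {H : Type} [Group H], (CrystalOrder (2 * 2) ∧ Iso H (D (2 * 2))) ∨
          Iso H (D 2 × Z 2) → Iso H (D 2 × Z 2) ∨ Iso H (D 4) :=
        fun h => h.symm.imp id fun h' => h'.2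
      exact (pair_or_swap (red oA) (red oB)).imp
        (fun t => Or.inr (Or.inr (Or.inr (Or.inr (Or.inr (Or.inl ⟨hF, t⟩))))))
        (fun t => Or.inr (Or.inr (Or.inr (Or.inr (Or.inr (Or.inl ⟨hF, t⟩))))))
    · have red : ∀ {H : Type} [Group H], (CrystalOrder (2 * 3) ∧ Iso H (D (2 * 3))) ∨
          Iso H (D 3 × Z 2) → Iso H (D 3 × Z 2) := by
        rintro H _ (⟨-, h⟩ | h)
        · exact h.trans iso_D_three_prod.symm
        · exact h
      exact Or.inl (Or.inr (Or.inr (Or.inr (Or.inr (Or.inr (Or.inr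
        (Or.inl ⟨hF, red oA, red oB⟩)))))))
    · have hno : ¬ CrystalOrder (2 * 4) := by unfold CrystalOrder; decide
      exact Or.inl (Or.inr (Or.inr (Or.inr (Or.inr (Or.inr (Or.inr (Or.inr
        (Or.inl ⟨hF, oA.resolve_left fun h' => hno h'.1,
          oB.resolve_left fun h' => hno h'.1⟩))))))))
    · have hno : ¬ CrystalOrder (2 * 6) := by unfold CrystalOrder; decide
      exact Or.inl (Or.inr (Or.inr (Or.inr (Or.inr (Or.inr (Or.inr (Or.inr
        (Or.inr ⟨hF, oA.resolve_left fun h' => hno h'.1,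
          oB.resolve_left fun h' => hno h'.1⟩))))))))

end Groups


/-! ### Amalgams with infinite dihedral quotient -/

section Amalgam
variable {G : Type*} [Group G]

theorem mem_infinite_dihedral_mul {a c : G} (haa : a * a = 1) (hac : a * c = c⁻¹ * a) {x y : G}
    (hx : ∃ k : ℤ, x = c ^ k ∨ x = c ^ k * a) (hy : ∃ k : ℤ, y = c ^ k ∨ y = c ^ k * a) :
    ∃ k : ℤ, x * y = c ^ k ∨ x * y = c ^ k * a := by
  have hsc : SemiconjBy a c c⁻¹ := hac
  have hk : ∀ k : ℤ, a * c ^ k = c ^ (-k) * a := fun k => by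
    have := hsc.zpow_right k
    rw [inv_zpow, ← zpow_neg] at this
    exact this
  obtain ⟨k, rfl | rfl⟩ := hx <;> obtain ⟨j, rfl | rfl⟩ := hy
  · exact ⟨k + j, Or.inl (zpow_add c k j).symm⟩
  · exact ⟨k + j, Or.inr (by rw [zpow_add, mul_assoc])⟩
  · exact ⟨k - j, Or.inr (by rw [mul_assoc, hk, ← mul_assoc, ← zpow_add, sub_eq_add_neg])⟩
  · exact ⟨k - j, Or.inl (by
      rw [mul_assoc, ← mul_assoc a, hk, mul_assoc, haa, mul_one, ← zpow_add, sub_eq_add_neg])⟩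

variable {F : Subgroup G} {K : Fin 2 → Subgroup G} (hF : ∀ i, F ≤ K i)

theorem range_base_normal (hn : F.Normal) :
    (Monoid.PushoutI.base (fun i => Subgroup.inclusion (hF i))).range.Normal := by
  refine ⟨fun n hn' x => ?_⟩
  induction x using Monoid.PushoutI.induction_on generalizing n with
  | of i g =>
    obtain ⟨f, rfl⟩ := hn'
    refine ⟨⟨g * f * (g : G)⁻¹, hn.conj_mem f f.2 g⟩, ?_⟩
    rw [← Monoid.PushoutI.of_apply_eq_base _ i, ← Monoid.PushoutI.of_apply_eq_base _ i,
      ← map_inv, ← map_mul, ← map_mul]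
    congr 1
  | base h =>
    exact Subgroup.mul_mem _ (Subgroup.mul_mem _ ⟨h, rfl⟩ hn') (Subgroup.inv_mem _ ⟨h, rfl⟩)
  | mul x y hx hy =>
    have := hx _ (hy n hn')
    simpa only [mul_inv_rev, mul_assoc] using this

/-- The amalgam of two subgroups over a common normal subgroup of index two maps isomorphically
onto a group whose quotient by this subgroup is infinite dihedral. -/
theorem bijective_pushout_lift (hn : F.Normal) (a : Fin 2 → G) (ha : ∀ i, a i ∈ K i)
    (haa : ∀ i, a i * a i ∈ F) (hK : ∀ i, ∀ x ∈ K i, x ∈ F ∨ x * a i ∈ F)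
    (hgen : ∀ g, ∃ k : ℤ, g * (a 0 * a 1) ^ k ∈ F ∨ g * (a 0 * a 1) ^ k * a 0 ∈ F)
    (hne : ∀ k : ℤ, (a 0 * a 1) ^ k ∈ F → k = 0)
    (hne' : ∀ k : ℤ, (a 0 * a 1) ^ k * a 0 ∉ F) :
    Function.Bijective (Monoid.PushoutI.lift (φ := fun i => Subgroup.inclusion (hF i))
      (fun i => (K i).subtype) F.subtype (fun _ => rfl)) := by
  set φ := fun i => Subgroup.inclusion (hF i)
  set L := Monoid.PushoutI.lift (φ := φ) (fun i => (K i).subtype) F.subtype (fun _ => rfl)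
  have hLof : ∀ i x, L (Monoid.PushoutI.of i x) = x := fun i x => Monoid.PushoutI.lift_of ..
  have hLbase : ∀ x, L (Monoid.PushoutI.base φ x) = x := fun x => Monoid.PushoutI.lift_base ..
  let α : Fin 2 → Monoid.PushoutI φ := fun i => Monoid.PushoutI.of i ⟨a i, ha i⟩
  have hLα : ∀ i, L (α i) = a i := fun i => hLof i _
  constructor
  -- Modulo `N`, the amalgam is generated by two involutions, so every class is `(α 0 α 1) ^ k` or
  -- `(α 0 α 1) ^ k α 0`. By `hne` and `hne'` a kernel element has trivial class, and `L` is
  -- injective on `N`.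
  · set N := (Monoid.PushoutI.base φ).range with hN
    have hNn : N.Normal := range_base_normal hF hn
    have hofN : ∀ i (x : K i), (x : G) ∈ F → Monoid.PushoutI.of i x ∈ N := fun i x hx =>
      ⟨⟨x, hx⟩, by rw [← Monoid.PushoutI.of_apply_eq_base φ i]; rfl⟩
    let q := QuotientGroup.mk' N
    have hq : ∀ x, q x = 1 ↔ x ∈ N := fun x => QuotientGroup.eq_one_iff x
    have hqα : ∀ i, q (α i) * q (α i) = 1 := fun i => by
      rw [← map_mul, hq, ← map_mul]
      exact hofN i _ (haa i)
    have hqα' : ∀ i, (q (α i))⁻¹ = q (α i) := fun i => inv_eq_of_mul_eq_one_left (hqα i)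
    have hc : q (α 0) * (q (α 0) * q (α 1)) = (q (α 0) * q (α 1))⁻¹ * q (α 0) := by
      rw [← mul_assoc, hqα, one_mul, mul_inv_rev, hqα', hqα', mul_assoc, hqα, mul_one]
    have hofq : ∀ i x, q (Monoid.PushoutI.of i x) = 1 ∨ q (Monoid.PushoutI.of i x) = q (α i) := by
      intro i x
      rcases hK i x x.2 with hx | hx
      · exact Or.inl ((hq _).2 (hofN i x hx))
      · right
        have h1 := (hq _).2 (hofN i (x * ⟨a i, ha i⟩) hx)
        rw [map_mul, map_mul] at h1
        rw [eq_inv_of_mul_eq_one_left h1]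
        exact hqα' i
    have hform : ∀ x, ∃ k : ℤ, q x = (q (α 0) * q (α 1)) ^ k ∨
        q x = (q (α 0) * q (α 1)) ^ k * q (α 0) := by
      intro x
      induction x using Monoid.PushoutI.induction_on with
      | of i g =>
        rcases hofq i g with h | h
        · exact ⟨0, Or.inl (by rw [h, zpow_zero])⟩
        · rw [h]
          fin_cases i
          · exact ⟨0, Or.inr (by simp)⟩
          · refine ⟨-1, Or.inr ?_⟩
            change q (α 1) = _
            rw [zpow_neg_one, ← hc, ← mul_assoc, hqα, one_mul]
      | base h =>
        exact ⟨0, Or.inl (by rw [zpow_zero, hq]; exact ⟨h, rfl⟩)⟩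
      | mul x y hx hy =>
        rw [map_mul]
        exact mem_infinite_dihedral_mul (hqα 0) hc hx hy
    have hLN : ∀ x ∈ N, L x ∈ F := by
      rintro _ ⟨f, rfl⟩
      rw [hLbase]
      exact f.2
    have hcoset : ∀ x y, q x = q y → L x = 1 → L y ∈ F := fun x y hxy hx => by
      have h1 := hLN _ (QuotientGroup.eq.1 hxy)
      rwa [map_mul, map_inv, hx, inv_one, one_mul] at h1
    rw [injective_iff_map_eq_one]
    intro x hx
    obtain ⟨k, hk | hk⟩ := hform x
    · have h1 := hcoset x ((α 0 * α 1) ^ k) (by rw [hk, map_zpow, map_mul]) hx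
      rw [map_zpow, map_mul, hLα, hLα] at h1
      rw [hne k h1, zpow_zero] at hk
      obtain ⟨f, rfl⟩ := (hq x).1 hk
      rw [hLbase] at hx
      rw [Subtype.ext hx (a2 := (1 : F)), map_one]
    · have h1 := hcoset x ((α 0 * α 1) ^ k * α 0) (by rw [hk, map_mul, map_zpow, map_mul]) hx
      rw [map_mul, map_zpow, map_mul, hLα, hLα] at h1
      exact (hne' k h1).elim
  · rw [← MonoidHom.range_eq_top, eq_top_iff]
    intro g _
    have hFL : ∀ x ∈ F, x ∈ L.range := fun x hx => ⟨Monoid.PushoutI.base φ ⟨x, hx⟩, hLbase _⟩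
    have hα : ∀ i, a i ∈ L.range := fun i => ⟨α i, hLα i⟩
    have hc : ∀ k : ℤ, (a 0 * a 1) ^ k ∈ L.range := fun k =>
      L.range.zpow_mem (L.range.mul_mem (hα 0) (hα 1)) k
    obtain ⟨k, hk | hk⟩ := hgen g
    · exact (L.range.mul_mem_cancel_right (hc k)).1 (hFL _ hk)
    · exact (L.range.mul_mem_cancel_right (hc k)).1
        ((L.range.mul_mem_cancel_right (hα 0)).1 (hFL _ hk))

end Amalgam


/-! ### The action of `G` in coordinates along and across the line -/

/-- Coordinates for the action of `G` on the line `l = p + ℝ u` and on the orthogonal plane: `g`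
acts on `l` by `t ↦ c g + σ g * t`, and on the plane by `ψ g`. -/
structure LineCoordinates (G : Subgroup (Isom 3)) (l : AffineSubspace ℝ (Space 3)) (p u : Space 3)
    (J : ℂ →ₗᵢ[ℝ] Space 3) (σ : G →* ℤˣ) (c : G → ℝ) (ψ : G →* (ℂ ≃ₗᵢ[ℝ] ℂ)) : Prop where
  unit : ‖u‖ = 1
  frame : IsFrame u J
  mem_iff : ∀ x, x ∈ l ↔ ∃ t : ℝ, x = p + t • u
  lin_axis : ∀ g : G, lin (g : Isom 3) u = ((σ g : ℤ) : ℝ) • u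
  lin_plane : ∀ (g : G) z, lin (g : Isom 3) (J z) = J (ψ g z)
  origin : ∀ g : G, (g : Isom 3) p = p + c g • u

theorem exists_line_parametrization {l : AffineSubspace ℝ (Space 3)} (hl : IsLine l) {p : Space 3}
    (hp : p ∈ l) : ∃ u : Space 3, ‖u‖ = 1 ∧ ∀ x, x ∈ l ↔ ∃ t : ℝ, x = p + t • u := by
  obtain ⟨⟨v, hvl⟩, hv0, hv⟩ := finrank_eq_one_iff'.1 hl
  have hv0' : v ≠ 0 := fun h => hv0 (Subtype.ext h)
  refine ⟨‖v‖⁻¹ • v, norm_smul_inv_norm hv0', fun x => ⟨fun hx => ?_, ?_⟩⟩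
  · obtain ⟨s, hs⟩ := hv ⟨x -ᵥ p, AffineSubspace.vsub_mem_direction hx hp⟩
    have hs' : s • v = x - p := congrArg Subtype.val hs
    refine ⟨s * ‖v‖, ?_⟩
    rw [smul_smul, mul_assoc, mul_inv_cancel₀ (norm_ne_zero_iff.2 hv0'), mul_one, hs']
    abel
  · rintro ⟨t, rfl⟩
    rw [add_comm]
    exact AffineSubspace.vadd_mem_of_mem_direction
      (l.direction.smul_mem _ (l.direction.smul_mem _ hvl)) hp

theorem exists_lineCoordinates {G : Subgroup (Isom 3)} {l : AffineSubspace ℝ (Space 3)}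
    (hl : IsLine l) (hG : ActsDihedrallyOn G l) {p : Space 3} (hp : p ∈ l) :
    ∃ u J σ c ψ, LineCoordinates G l p u J σ c ψ := by
  obtain ⟨u, hu, hmem⟩ := exists_line_parametrization hl hp
  obtain ⟨J, hJ⟩ := exists_isFrame hu
  have hu0 : u ≠ 0 := by rintro rfl; simp at hu
  have hinv : ∀ (g : G) x, x ∈ l → (g : Isom 3) x ∈ l := fun g x hx => by
    have h := hG.invariant g g.2
    have : (g : Isom 3) • x ∈ (l : Set (Space 3)) := h ▸ ⟨x, hx, rfl⟩
    exact this
  have hc : ∀ g : G, ∃ c : ℝ, (g : Isom 3) p = p + c • u := fun g => (hmem _).1 (hinv g p hp)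
  choose c hc using hc
  have hσ : ∀ g : G, ∃ s : ℤˣ, lin (g : Isom 3) u = ((s : ℤ) : ℝ) • u := fun g => by
    obtain ⟨t, ht⟩ := (hmem _).1 (hinv g (p + u) ((hmem _).2 ⟨1, by simp⟩))
    have h1 : lin (g : Isom 3) u = (t - c g) • u := by
      have := apply_sub_apply (g : Isom 3) (p + u) p
      rw [ht, hc, add_sub_cancel_left, add_sub_add_left_eq_sub, ← sub_smul] at this
      exact this.symm
    have h2 : |t - c g| = 1 := by
      have := congrArg norm h1
      rw [LinearIsometryEquiv.norm_map, norm_smul, hu, mul_one] at this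
      exact this.symm
    rcases eq_or_eq_neg_of_abs_eq h2 with h | h
    · exact ⟨1, by rw [h1, h]; simp⟩
    · exact ⟨-1, by rw [h1, h]; simp⟩
  choose s hs using hσ
  have hs2 : ∀ g, (((s g : ℤ) : ℝ)) ^ 2 = 1 := fun g => by
    rcases Int.units_eq_one_or (s g) with h | h <;> rw [h] <;> norm_num
  choose B hB using fun g : G => hJ.exists_plane_isometry (hs2 g) (hs g)
  refine ⟨u, J, MonoidHom.mk' s fun g h => ?_, c, MonoidHom.mk' B fun g h => ?_,
    hu, hJ, hmem, hs, hB, hc⟩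
  · have h1 : lin ((g * h : G) : Isom 3) u = lin (g : Isom 3) (lin (h : Isom 3) u) := by
      rw [Subgroup.coe_mul, map_mul]; rfl
    rw [hs, hs, map_smul, hs, smul_smul] at h1
    have h2 := smul_left_injective ℝ hu0 h1
    rw [mul_comm] at h2
    ext
    push_cast
    exact_mod_cast h2
  · ext1 z
    apply J.injective
    rw [← hB]
    have h1 : lin ((g * h : G) : Isom 3) (J z) = lin (g : Isom 3) (lin (h : Isom 3) (J z)) := by
      rw [Subgroup.coe_mul, map_mul]; rfl
    rw [h1, hB, hB]
    rfl

namespace LineCoordinates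
variable {G : Subgroup (Isom 3)} {l : AffineSubspace ℝ (Space 3)} {p u : Space 3}
  {J : ℂ →ₗᵢ[ℝ] Space 3} {σ : G →* ℤˣ} {c : G → ℝ} {ψ : G →* (ℂ ≃ₗᵢ[ℝ] ℂ)}

section
variable (h : LineCoordinates G l p u J σ c ψ)
include h

theorem point_injective {s t : ℝ} (hst : p + s • u = p + t • u) : s = t := by
  have hu0 : u ≠ 0 := by
    rintro rfl
    simpa using h.unit
  exact smul_left_injective ℝ hu0 (add_left_cancel hst)

theorem apply_point (g : G) (t : ℝ) :
    (g : Isom 3) (p + t • u) = p + (c g + ((σ g : ℤ) : ℝ) * t) • u := by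
  rw [apply_eq_lin _ _ p, add_sub_cancel_left, map_smul, h.lin_axis, h.origin]
  module

theorem c_mul (g k : G) : c (g * k) = c g + ((σ g : ℤ) : ℝ) * c k := by
  apply h.point_injective
  rw [← h.origin, ← h.apply_point, ← h.origin]
  rfl

theorem mem_isotropy_iff (g : G) (t : ℝ) :
    g ∈ isotropy G (p + t • u) ↔ c g + ((σ g : ℤ) : ℝ) * t = t := by
  constructor
  · intro hg
    apply h.point_injective
    rw [← h.apply_point]
    exact hg
  · intro hg
    change (g : Isom 3) (p + t • u) = p + t • u
    rw [h.apply_point, hg]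

theorem mem_fixer_iff (g : G) : g ∈ pointwiseFixer G l ↔ σ g = 1 ∧ c g = 0 := by
  have hfix : g ∈ pointwiseFixer G l ↔ ∀ t : ℝ, g ∈ isotropy G (p + t • u) := by
    constructor
    · intro hg t
      exact hg ⟨_, (h.mem_iff _).2 ⟨t, rfl⟩⟩
    · rintro hg ⟨x, hx⟩
      obtain ⟨t, rfl⟩ := (h.mem_iff x).1 hx
      exact hg t
  rw [hfix]
  simp only [h.mem_isotropy_iff]
  constructor
  · intro hg
    have h0 := hg 0
    have h1 := hg 1
    have hc : c g = 0 := by linarith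
    refine ⟨?_, hc⟩
    ext
    push_cast
    have : ((σ g : ℤ) : ℝ) = 1 := by linarith
    exact_mod_cast this
  · rintro ⟨h1, h2⟩ t
    rw [h1, h2]
    simp

theorem fixer_normal : (pointwiseFixer G l).Normal := by
  refine ⟨fun f hf g => ?_⟩
  rw [h.mem_fixer_iff] at hf ⊢
  have h1 : c (g * g⁻¹) = 0 := by
    rw [mul_inv_cancel]
    exact ((h.mem_fixer_iff 1).1 (one_mem _)).2
  refine ⟨by simp [hf.1], ?_⟩
  rw [h.c_mul] at h1
  rw [h.c_mul, h.c_mul, hf.2, map_mul, hf.1]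
  simpa using h1

/-- The conditions on `a` say that it reflects `l` about `q`. Faithfulness holds because an isometry
fixing `q` is determined by its linear part. -/
theorem isDoubleExtension {Γ : Subgroup (Isom 3)} (hΓ : IsCrystallographic Γ) (hGΓ : G ≤ Γ)
    (q : l) {t : ℝ} (hq : (q : Space 3) = p + t • u) {a : G} (ha : σ a = -1) (hca : c a = 2 * t) :
    IsDoubleExtension (Subgroup.inclusion (pointwiseFixer_le_isotropy G l q))
      (σ.comp (isotropy G (q : Space 3)).subtype) (ψ.comp (isotropy G (q : Space 3)).subtype) where
  injective := Subgroup.inclusion_injective _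
  exact := by
    rintro ⟨g, hg⟩
    change σ g = 1 ↔ _
    constructor
    · intro h1
      have hc : c g = 0 := by
        rw [hq, h.mem_isotropy_iff, h1] at hg
        simpa using hg
      exact ⟨⟨g, (h.mem_fixer_iff g).2 ⟨h1, hc⟩⟩, rfl⟩
    · rintro ⟨f, hf⟩
      have : (f : G) = g := congrArg Subtype.val hf
      rw [← this]
      exact ((h.mem_fixer_iff _).1 f.2).1
  exists_neg := by
    refine ⟨⟨a, ?_⟩, ha⟩
    rw [hq, h.mem_isotropy_iff, ha, hca]
    push_cast
    ring
  faithful := by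
    rintro ⟨g, hg⟩ (h1 : σ g = 1) (h2 : ψ g = 1)
    have hlin : lin (g : Isom 3) = 1 := by
      ext1 x
      obtain ⟨z, hz⟩ := h.frame.exists_decomp h.unit x
      rw [hz, map_add, map_smul, h.lin_axis, h.lin_plane, h1, h2]
      simp
    apply Subtype.ext
    apply Subtype.ext
    exact isom_ext_of_lin (q : Space 3) (by rw [hlin]; exact (map_one lin).symm) hg
  restricted := by
    rintro ⟨g, hg⟩ a (hga : ψ g = rotation a)
    refine hΓ.pow_eq_one h.unit h.frame (hGΓ g.2) (s := ((σ g : ℤ) : ℝ)) ?_ (h.lin_axis g) ?_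
    · rcases Int.units_eq_one_or (σ g) with h | h <;> rw [h] <;> norm_num
    · intro z
      rw [h.lin_plane, hga, rotation_apply]

theorem fixer_finite {Γ : Subgroup (Isom 3)} (hΓ : IsCrystallographic Γ) (hGΓ : G ≤ Γ) :
    Finite (pointwiseFixer G l) := by
  have hfin := (hΓ.finite_dist_le p p 0).to_subtype
  refine Finite.of_injective (fun f : pointwiseFixer G l =>
    (⟨((f : G) : Isom 3), hGΓ (f : G).2, ?_⟩ : {g : Isom 3 | g ∈ Γ ∧ dist (g p) p ≤ 0})) ?_
  · rw [h.origin, ((h.mem_fixer_iff _).1 f.2).2]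
    simp
  · intro f f' hff
    have hff' : ((f : G) : Isom 3) = ((f' : G) : Isom 3) := by
      simpa only [Subtype.mk.injEq] using hff
    exact Subtype.ext (Subtype.ext hff')

theorem c_one : c 1 = 0 := ((h.mem_fixer_iff 1).1 (one_mem _)).2

theorem c_zpow {g : G} (hg : σ g = 1) (k : ℤ) : c (g ^ k) = k * c g := by
  have hσ : ∀ k : ℤ, σ (g ^ k) = 1 := fun k => by rw [map_zpow, hg, one_zpow]
  have h1 : ∀ k : ℤ, c (g ^ (k + 1)) = c (g ^ k) + c g := fun k => by
    rw [zpow_add_one, h.c_mul, hσ]; simp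
  induction k with
  | zero => simpa using h.c_one
  | succ i hi => rw [h1, hi]; push_cast; ring
  | pred i hi =>
    have := h1 (-i - 1)
    rw [sub_add_cancel, hi] at this
    push_cast at this ⊢
    linarith

/-- The lengths of the translations of `l` induced by `G`. -/
def translationLengths : AddSubgroup ℝ where
  carrier := {x | ∃ g : G, σ g = 1 ∧ c g = x}
  zero_mem' := ⟨1, map_one σ, h.c_one⟩
  add_mem' := by
    rintro x y ⟨g, hg, rfl⟩ ⟨k, hk, rfl⟩
    exact ⟨g * k, by rw [map_mul, hg, hk, one_mul], by rw [h.c_mul, hg]; simp⟩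
  neg_mem' := by
    rintro x ⟨g, hg, rfl⟩
    exact ⟨g⁻¹, by rw [map_inv, hg, inv_one], by simpa using h.c_zpow hg (-1)⟩

theorem exists_generator {Γ : Subgroup (Isom 3)} (hΓ : IsCrystallographic Γ) (hGΓ : G ≤ Γ) :
    ∃ b, h.translationLengths = AddSubgroup.closure {b} := by
  have hfin : {x : ℝ | x ∈ h.translationLengths ∧ 0 < x ∧ x ≤ 1}.Finite := by
    have hfin' := hΓ.finite_dist_le p p 1
    refine (hfin'.image (fun g => inner ℝ u (g p - p))).subset ?_
    rintro x ⟨⟨g, -, rfl⟩, h0, h1⟩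
    refine ⟨g, ⟨hGΓ g.2, ?_⟩, ?_⟩
    · rw [h.origin, dist_eq_norm, add_sub_cancel_left, norm_smul, h.unit, mul_one,
        Real.norm_of_nonneg h0.le]
      exact h1
    · simp only
      rw [h.origin, add_sub_cancel_left, inner_smul_right, real_inner_self_eq_norm_sq, h.unit]
      ring
  by_cases hne : {x : ℝ | x ∈ h.translationLengths ∧ 0 < x ∧ x ≤ 1}.Nonempty
  · obtain ⟨x, hx, hmin⟩ := Set.exists_min_image _ id hfin hne
    refine AddSubgroup.cyclic_of_isolated_zero hx.2.1 (Set.disjoint_left.2 fun y hy hy' => ?_)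
    exact absurd (hmin y ⟨hy, hy'.1, hy'.2.le.trans hx.2.2⟩) (not_le.2 hy'.2)
  -- With no length in `(0, 1]`, the bound 1 itself isolates zero.
  · refine AddSubgroup.cyclic_of_isolated_zero one_pos (Set.disjoint_left.2 fun y hy hy' => ?_)
    exact hne ⟨y, hy, hy'.1, hy'.2.le⟩

/-- Without translations, every orientation-reversing element acts on `l` as `a` does, so the
translates of a compact set stay bounded. -/
theorem exists_translation (hcc : ActsCocompactlyOn G (l : Set (Space 3))) {a : G}
    (ha : σ a = -1) : ∃ x ∈ h.translationLengths, x ≠ 0 := by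
  by_contra! hcon
  obtain ⟨K, hKl, hK, hcov⟩ := hcc
  obtain ⟨R, hR⟩ := hK.isBounded.subset_closedBall p
  obtain ⟨g, hg, y, hy, hgy⟩ := hcov (p + (|c a| + |R| + 1) • u) ((h.mem_iff _).2 ⟨_, rfl⟩)
  obtain ⟨t, rfl⟩ := (h.mem_iff y).1 (hKl hy)
  have ht : |t| ≤ |R| := by
    have := hR hy
    rw [Metric.mem_closedBall, dist_eq_norm, add_sub_cancel_left, norm_smul, h.unit, mul_one] at this
    exact this.trans (le_abs_self R)
  have h1 := h.point_injective ((h.apply_point ⟨g, hg⟩ t).symm.trans hgy)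
  have h2 := abs_le.1 ht
  have h3 := le_abs_self (c a)
  rcases Int.units_eq_one_or (σ ⟨g, hg⟩) with hσ | hσ
  · rw [hcon _ ⟨_, hσ, rfl⟩, hσ] at h1
    simp only [Units.val_one, Int.cast_one] at h1
    linarith [abs_nonneg (c a)]
  · have h4 := hcon _ ⟨⟨g, hg⟩ * a, by rw [map_mul, hσ, ha]; rfl, rfl⟩
    rw [h.c_mul, hσ] at h4
    rw [hσ] at h1
    push_cast at h1 h4
    linarith

/-- The amalgam decomposition, for two reflections of `l` whose product generates the
translations. -/
theorem exists_amalgam_equiv (q : Fin 2 → l) (t : Fin 2 → ℝ) (hq : ∀ i, (q i : Space 3) = p + t i • u)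
    (a : Fin 2 → G) (ha : ∀ i, σ (a i) = -1) (hca : ∀ i, c (a i) = 2 * t i) (ht : t 0 ≠ t 1)
    (hT : ∀ g, σ g = 1 → ∃ k : ℤ, c g = k * (2 * (t 1 - t 0))) :
    ∃ e : IsotropyAmalgam G l q ≃* G, ∀ (i : Fin 2) (g : isotropy G (q i : Space 3)),
      e (IsotropyAmalgam.of G l q i g) = (g : G) := by
  have hneg : ((-1 : ℤˣ) : ℤ) = -1 := rfl
  have hab : σ (a 0 * a 1) = 1 := by rw [map_mul, ha, ha]; rfl
  have habk : ∀ k : ℤ, σ ((a 0 * a 1) ^ k) = 1 := fun k => by rw [map_zpow, hab, one_zpow]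
  have hcab : ∀ k : ℤ, c ((a 0 * a 1) ^ k) = k * (2 * (t 0 - t 1)) := fun k => by
    rw [h.c_zpow hab, h.c_mul, ha, hca, hca, hneg]; push_cast; ring
  have key := bijective_pushout_lift (fun i => pointwiseFixer_le_isotropy G l (q i))
    h.fixer_normal a ?_ ?_ ?_ ?_ ?_ ?_
  · refine ⟨MulEquiv.ofBijective _ key, fun i g => ?_⟩
    exact Monoid.PushoutI.lift_of (φ := fun i => Subgroup.inclusion
      (pointwiseFixer_le_isotropy G l (q i))) (fun i => (isotropy G (q i : Space 3)).subtype)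
      (pointwiseFixer G l).subtype (fun _ => rfl) g
  · intro i
    rw [hq, h.mem_isotropy_iff, ha, hca, hneg]; push_cast; ring
  · intro i
    rw [h.mem_fixer_iff, map_mul, h.c_mul, ha, hca, hneg]
    exact ⟨rfl, by push_cast; ring⟩
  · intro i x hx
    rw [hq, h.mem_isotropy_iff] at hx
    rw [h.mem_fixer_iff, h.mem_fixer_iff, map_mul, h.c_mul, ha, hca]
    rcases Int.units_eq_one_or (σ x) with h1 | h1
    · left
      rw [h1] at hx
      exact ⟨h1, by simpa using hx⟩
    · right
      rw [h1, hneg] at hx ⊢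
      push_cast at hx ⊢
      exact ⟨rfl, by linarith⟩
  · intro g
    rcases Int.units_eq_one_or (σ g) with h1 | h1
    · obtain ⟨k, hk⟩ := hT g h1
      refine ⟨k, Or.inl ?_⟩
      rw [h.mem_fixer_iff, map_mul, h.c_mul, h1, habk, hcab, hk]
      exact ⟨rfl, by push_cast; ring⟩
    · obtain ⟨k, hk⟩ := hT (g * a 0) (by rw [map_mul, h1, ha]; rfl)
      rw [h.c_mul, h1, hca, hneg] at hk
      -- The sign is opposite to the previous case because `g` reverses `l`, and so negates the
      -- translation applied before it.
      refine ⟨-k, Or.inr ?_⟩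
      rw [h.mem_fixer_iff, map_mul, map_mul, h.c_mul, h.c_mul, map_mul, h1, habk, hcab, ha, hca,
        mul_one, hneg]
      refine ⟨rfl, ?_⟩
      push_cast at hk ⊢
      linarith
  · intro k hk
    rw [h.mem_fixer_iff, hcab] at hk
    have := hk.2
    have h2 : (2 * (t 0 - t 1)) ≠ 0 := mul_ne_zero two_ne_zero (sub_ne_zero.2 ht)
    exact_mod_cast (mul_eq_zero.1 this).resolve_right h2
  · intro k hk
    have := ((h.mem_fixer_iff _).1 hk).1
    rw [map_mul, habk, ha] at this
    exact absurd this (by decide)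

end

end LineCoordinates

end Crystal

/-! ### Choice of the two points -/

open Crystal in
theorem proposition3p2
    (Γ : Subgroup (Crystal.Isom 3)) (hΓ : Crystal.IsCrystallographic Γ)
    (G : Subgroup (Crystal.Isom 3)) (hGΓ : G ≤ Γ)
    (l : AffineSubspace ℝ (Crystal.Space 3)) (hl : Crystal.IsLine l)
    (hG : Crystal.ActsDihedrallyOn G l) :
    ∃ p : Fin 2 → l, p 0 ≠ p 1 ∧
      (∃ e : Crystal.IsotropyAmalgam G l p ≃* G,
        ∀ (i : Fin 2) (g : Crystal.isotropy G (p i)),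
          e (Crystal.IsotropyAmalgam.of G l p i g) = (g : G)) ∧
      Crystal.DihedralTable (Crystal.pointwiseFixer G l)
        (Crystal.isotropy G (p 0)) (Crystal.isotropy G (p 1)) := by
  obtain ⟨r, hr, p, hp, hrefl⟩ := hG.exists_reflection
  obtain ⟨u, J, σ, c, ψ, h⟩ := exists_lineCoordinates hl hG hp
  have hrp : c ⟨r, hr⟩ = 0 := by
    apply h.point_injective
    rw [← h.origin, zero_smul, add_zero]
    exact (hrefl p hp).trans (AffineEquiv.pointReflection_self ℝ p)
  have hrσ : σ ⟨r, hr⟩ = -1 := by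
    refine (Int.units_eq_one_or _).resolve_left fun h1 => ?_
    have h2 := h.apply_point ⟨r, hr⟩ 1
    have h3 := hrefl (p + (1 : ℝ) • u) ((h.mem_iff _).2 ⟨1, rfl⟩)
    rw [AffineEquiv.pointReflection_apply] at h3
    have h4 : (p -ᵥ (p + (1 : ℝ) • u)) +ᵥ p = p + (-1 : ℝ) • u := by
      rw [vsub_eq_sub, vadd_eq_add]; module
    have h5 := h.point_injective (h2.symm.trans (h3.trans h4))
    rw [hrp, h1] at h5
    norm_num at h5
  obtain ⟨b, hb⟩ := h.exists_generator hΓ hGΓ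
  obtain ⟨x, hx, hx0⟩ := h.exists_translation hG.cocompact hrσ
  have hb0 : b ≠ 0 := by
    rintro rfl
    rw [hb, AddSubgroup.closure_singleton_zero] at hx
    exact hx0 hx
  obtain ⟨τ, hτσ, hτ⟩ : ∃ g : G, σ g = 1 ∧ c g = b := by
    have : b ∈ h.translationLengths := hb ▸ AddSubgroup.subset_closure rfl
    exact this
  have hT : ∀ g, σ g = 1 → ∃ k : ℤ, c g = k * b := fun g hg => by
    have hmem : c g ∈ h.translationLengths := ⟨g, hg, rfl⟩
    rw [hb, AddSubgroup.mem_closure_singleton] at hmem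
    obtain ⟨k, hk⟩ := hmem
    exact ⟨k, by rw [← hk, zsmul_eq_mul]⟩
  -- A reflection `t ↦ b - t` has its fixed point at `b / 2`, which gives the second point.
  have hτr : σ (τ * ⟨r, hr⟩) = -1 := by rw [map_mul, hτσ, hrσ]; rfl
  have hτrc : c (τ * ⟨r, hr⟩) = b := by rw [h.c_mul, hrp, hτ]; simp
  have hmain : ∀ (t : Fin 2 → ℝ) (a : Fin 2 → G), (∀ i, σ (a i) = -1) → (∀ i, c (a i) = 2 * t i) →
      t 0 ≠ t 1 → (∀ g, σ g = 1 → ∃ k : ℤ, c g = k * (2 * (t 1 - t 0))) →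
      ∀ q : Fin 2 → l, (∀ i, (q i : Space 3) = p + t i • u) →
      DihedralTable (pointwiseFixer G l) (isotropy G (q 0 : Space 3)) (isotropy G (q 1 : Space 3)) →
      ∃ p : Fin 2 → l, p 0 ≠ p 1 ∧
      (∃ e : Crystal.IsotropyAmalgam G l p ≃* G,
        ∀ (i : Fin 2) (g : Crystal.isotropy G (p i : Space 3)),
          e (Crystal.IsotropyAmalgam.of G l p i g) = (g : G)) ∧
      Crystal.DihedralTable (Crystal.pointwiseFixer G l)
        (Crystal.isotropy G (p 0 : Space 3)) (Crystal.isotropy G (p 1 : Space 3)) := by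
    intro t a ha hca ht hT' q hq htab
    refine ⟨q, fun h01 => ht (h.point_injective ?_), ?_, htab⟩
    · rw [← hq, ← hq, h01]
    · exact h.exists_amalgam_equiv q t hq a ha hca ht hT'
  let q₀ : l := ⟨p + (0 : ℝ) • u, (h.mem_iff _).2 ⟨_, rfl⟩⟩
  let q₁ : l := ⟨p + (b / 2) • u, (h.mem_iff _).2 ⟨_, rfl⟩⟩
  have hfin := h.fixer_finite hΓ hGΓ
  -- The order of the two points is chosen to match the order in which the table lists the pair.
  rcases dihedralTable_or_swap
    (h.isDoubleExtension hΓ hGΓ q₀ rfl hrσ (by rw [hrp, mul_zero]))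
    (h.isDoubleExtension hΓ hGΓ q₁ rfl hτr (by rw [hτrc]; ring)) rfl with htab | htab
  · refine hmain ![0, b / 2] ![⟨r, hr⟩, τ * ⟨r, hr⟩] ?_ ?_ ?_ ?_ ![q₀, q₁] ?_ htab
    · intro i; fin_cases i <;> assumption
    · intro i; fin_cases i
      · simpa using hrp
      · simp only [Fin.mk_one, Matrix.cons_val_one, Matrix.cons_val_zero]; rw [hτrc]; ring
    · exact (div_ne_zero hb0 two_ne_zero).symm
    · intro g hg
      obtain ⟨k, hk⟩ := hT g hg
      exact ⟨k, by rw [hk]; change _ = (k : ℝ) * (2 * (b / 2 - 0)); ring⟩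
    · intro i; fin_cases i <;> rfl
  · refine hmain ![b / 2, 0] ![τ * ⟨r, hr⟩, ⟨r, hr⟩] ?_ ?_ ?_ ?_ ![q₁, q₀] ?_ htab
    · intro i; fin_cases i <;> assumption
    · intro i; fin_cases i
      · simp only [Fin.zero_eta, Matrix.cons_val_zero]; rw [hτrc]; ring
      · simpa using hrp
    · exact div_ne_zero hb0 two_ne_zero
    · intro g hg
      obtain ⟨k, hk⟩ := hT g hg
      exact ⟨-k, by rw [hk]; change _ = ((-k : ℤ) : ℝ) * (2 * (0 - b / 2)); push_cast; ring⟩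
    · intro i; fin_cases i <;> rfl
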